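/- Let $S$ be a finite set of positive integers whose elements have greatest common divisor $1$, and let $m=\max S$. Let $p_n$ be the probability that a uniformly random permutation of $\{1,\dots,n\}$ has all its cycle lengths in $S$ (fixed points count as cycles of length $1$). Put $A(t)=\sum_{s\in S}t^{m-s}$, a polynomial with constant term $1$; write $[t^k]$ for the coefficient of $t^k$ in a formal power series, where $A(t)^{\alpha}$ and $\log A(t)$ are the usual binomial and logarithmic series in $A(t)-1$. Define $$f_S(x)=\sum_{k=1}^{m-1}\frac{m}{k(m-k)}\,\bigl([t^k]A(t)^{k/m}\bigr)\,x^{m-k},\qquad C_S=\frac{(2\pi)^{1/(2m)}}{\sqrt{2\pi m}}\exp\Bigl(-\frac1m\sum_{s\in S}[t^s]\log A(t)\Bigr)>0 .$$ Then, as $n\to\infty$, $$p_n\cdot (n!)^{1/m}\;\sim\; C_S\,n^{-\frac12+\frac1{2m}}\exp\bigl(f_S(n^{1/m})\bigr).$$ The polynomial $f_S$ has degree at most $m-1$; more precisely, its degree is the largest element of $S\setminus\{m\}$, and $f_S=0$ if $S=\{1\}$. (For $m\ge 2$ the degree is therefore $m-1$ exactly when $m-1\in S$.) Consequently $$\lim_{n\to\infty}\frac{\log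 p_n}{\log n!}=-\frac1m .$$ -/

import Mathlib

open Filter Topology Asymptotics
open scoped Nat Polynomial

noncomputable section

/-- `σ` is an `S`-permutation: all its cycle lengths lie in `S`. The parts of `σ.partition` are
the cycle lengths of `σ`, with each fixed point counted as a cycle of length one. -/
def IsSPermutation {n : ℕ} (S : Finset ℕ) (σ : Equiv.Perm (Fin n)) : Prop :=
  ∀ k ∈ σ.partition.parts, k ∈ S

/-- The probability that a uniformly random permutation of `n` points is an `S`-permutation. -/
def sPermProb (S : Finset ℕ) (n : ℕ) : ℝ :=
  (Nat.card {σ : Equiv.Perm (Fin n) // IsSPermutation S σ} : ℝ) / (n ! : ℝ)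

/-- `B(t) = ∑_{s ∈ S, s ≠ m} t^(m - s)`. For `m = max S` one has
`∑_{s ∈ S} z^s = z^m * (1 + B(1/z))`. -/
def revTail (S : Finset ℕ) (m : ℕ) : ℝ[X] :=
  ∑ s ∈ S.erase m, Polynomial.X ^ (m - s)

/-- The generalized binomial coefficient `α (α - 1) ⋯ (α - j + 1) / j!`. -/
def genBinom (α : ℝ) (j : ℕ) : ℝ :=
  (∏ i ∈ Finset.range j, (α - i)) / (j ! : ℝ)

/-- The coefficient of `t^k` in the formal power series `(1 + B(t))^α = ∑_j (α choose j) B(t)^j`,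
for a polynomial `B` without constant term (so that the terms with `j > k` do not contribute). -/
def powCoeff (B : ℝ[X]) (α : ℝ) (k : ℕ) : ℝ :=
  ∑ j ∈ Finset.range (k + 1), genBinom α j * (B ^ j).coeff k

/-- The coefficient of `t^k` in the formal power series
`log (1 + B(t)) = ∑_{j ≥ 1} (-1)^(j+1) B(t)^j / j`, for a polynomial `B` without constant term
(so that the terms with `j > k` do not contribute). -/
def logCoeff (B : ℝ[X]) (k : ℕ) : ℝ :=
  ∑ j ∈ Finset.Icc 1 k, (-1 : ℝ) ^ (j + 1) / (j : ℝ) * (B ^ j).coeff k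

/-- The polynomial `f_S(x) = ∑_{k=1}^{m-1} (m / (k (m - k))) [t^k] (1 + B(t))^(k/m) x^(m-k)`. -/
def leadingPoly (S : Finset ℕ) (m : ℕ) : ℝ[X] :=
  ∑ k ∈ Finset.Ico 1 m,
    Polynomial.C ((m : ℝ) / ((k : ℝ) * ((m : ℝ) - (k : ℝ))) *
      powCoeff (revTail S m) ((k : ℝ) / (m : ℝ)) k) * Polynomial.X ^ (m - k)

/-- The constant
`C_S = (2π)^(1/(2m)) (2πm)^(-1/2) exp (-(1/m) ∑_{s ∈ S} [t^s] log (1 + B(t)))`. -/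
def leadingConst (S : Finset ℕ) (m : ℕ) : ℝ :=
  (2 * Real.pi) ^ ((1 : ℝ) / (2 * (m : ℝ))) / Real.sqrt (2 * Real.pi * (m : ℝ)) *
    Real.exp (-(1 / (m : ℝ)) * ∑ s ∈ S, logCoeff (revTail S m) s)

end

/-! By the exponential formula, `∑ p_n z^n = exp P(z)` with `P(z) = ∑_{s ∈ S} z^s / s`, an entire
function, so Cauchy's formula on a circle of radius `r` recovers `p_n`. Choose the saddle point `r`,
where `r P'(r) = ∑ r^s = n`. For `|θ| ≤ π/m` the integrand is dominated by a Gaussian governed by `V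
= ∑ s r^s ~ m n`; on the rest of the circle, gcd 1 forces decay exponential in `r`. Hence `p_n ~
e^{P(r)} / (r^n √(2π m n))` (`tendsto_integral_saddleExponent`, `tendsto_sPermProb_mul`).

It remains to expand the exponent. Put `w = 1/r`, `A = 1 + B` and `Q(w) = ∑ w^{m-s} / s`. Then `n =
r^m A(w)` and `P(r) = n Q(w) / A(w)`, so `P(r) - n log r + (n log n - n)/m = n H(w)` with `H = Q/A +
(log A)/m - 1/m`. Since `y = n^{-1/m}` equals `w A(w)^{-1/m}`, Lagrange inversion expands `H` in
powers of `y` (`coeff_sub_lagrange_expansion`). Multiplication by `n` turns `y^k` into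
`n^{(m-k)/m}`: the terms `k < m` form `f_S`, the term `k = m` is the constant in the exponential of
`C_S`, and the error `n w^{m+1}` vanishes (`tendsto_saddle_exponent`). Stirling's formula for
`(n!)^{1/m}` cancels `(n log n - n)/m` and supplies the other factors.

The series `A^α` and `log A` are taken to be Taylor series of actual functions. Their algebra then
comes from identities between germs, and agreement of coefficients gives a genuine error bound. -/

/-! ### Taylor series of real analytic germs -/

/-- The Taylor series at `0` of a real function. -/
noncomputable def taylorSeries (f : ℝ → ℝ) : PowerSeries ℝ :=
  PowerSeries.mk fun k => iteratedDeriv k f 0 / (k ! : ℝ)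

namespace taylorSeries

variable {f g : ℝ → ℝ}

theorem coeff_eq (f : ℝ → ℝ) (k : ℕ) :
    PowerSeries.coeff k (taylorSeries f) = iteratedDeriv k f 0 / (k ! : ℝ) :=
  PowerSeries.coeff_mk _ _

theorem congr (h : f =ᶠ[𝓝 0] g) : taylorSeries f = taylorSeries g := by
  ext k
  rw [coeff_eq, coeff_eq, h.iteratedDeriv_eq]

theorem constantCoeff_eq (f : ℝ → ℝ) : PowerSeries.constantCoeff (taylorSeries f) = f 0 := by
  rw [← PowerSeries.coeff_zero_eq_constantCoeff_apply, coeff_eq]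
  simp

theorem add (hf : AnalyticAt ℝ f 0) (hg : AnalyticAt ℝ g 0) :
    taylorSeries (fun x => f x + g x) = taylorSeries f + taylorSeries g := by
  ext k
  rw [map_add, coeff_eq, coeff_eq, coeff_eq,
    iteratedDeriv_fun_add hf.contDiffAt hg.contDiffAt, add_div]

theorem const_mul (c : ℝ) (f : ℝ → ℝ) :
    taylorSeries (fun x => c * f x) = c • taylorSeries f := by
  ext k
  rw [map_smul, coeff_eq, coeff_eq, iteratedDeriv_const_mul_field, smul_eq_mul, mul_div_assoc]

theorem const (c : ℝ) : taylorSeries (fun _ => c) = PowerSeries.C c := by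
  ext k
  rw [coeff_eq, iteratedDeriv_const, PowerSeries.coeff_C]
  split_ifs with h <;> simp [h]

theorem sub (hf : AnalyticAt ℝ f 0) (hg : AnalyticAt ℝ g 0) :
    taylorSeries (fun x => f x - g x) = taylorSeries f - taylorSeries g := by
  ext k
  rw [map_sub, coeff_eq, coeff_eq, coeff_eq,
    iteratedDeriv_fun_sub hf.contDiffAt hg.contDiffAt, sub_div]

theorem mul (hf : AnalyticAt ℝ f 0) (hg : AnalyticAt ℝ g 0) :
    taylorSeries (fun x => f x * g x) = taylorSeries f * taylorSeries g := by
  ext k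
  rw [PowerSeries.coeff_mul, coeff_eq, iteratedDeriv_fun_mul hf.contDiffAt hg.contDiffAt,
    Finset.Nat.sum_antidiagonal_eq_sum_range_succ_mk, Finset.sum_div]
  refine Finset.sum_congr rfl fun i hi => ?_
  have hik : i ≤ k := Nat.lt_succ_iff.1 (Finset.mem_range.1 hi)
  rw [coeff_eq, coeff_eq, Nat.cast_choose ℝ hik]
  have := Nat.factorial_ne_zero k
  field_simp

theorem sum {ι : Type*} (s : Finset ι) (F : ι → ℝ → ℝ) (h : ∀ i ∈ s, AnalyticAt ℝ (F i) 0) :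
    taylorSeries (fun x => ∑ i ∈ s, F i x) = ∑ i ∈ s, taylorSeries (F i) := by
  classical
  induction s using Finset.induction_on with
  | empty => simpa using const 0
  | insert a s ha ih =>
    have h' : ∀ i ∈ s, AnalyticAt ℝ (F i) 0 := fun i hi => h i (Finset.mem_insert_of_mem hi)
    have hs : AnalyticAt ℝ (fun x => ∑ i ∈ s, F i x) 0 := Finset.analyticAt_fun_sum s h'
    simp_rw [Finset.sum_insert ha]
    rw [add (h a (Finset.mem_insert_self a s)) hs, ih h']

theorem id : taylorSeries (fun x => x) = PowerSeries.X := by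
  ext k
  rw [coeff_eq, iteratedDeriv_fun_id_zero, PowerSeries.coeff_X]
  split_ifs with h <;> simp [h]

theorem pow (hf : AnalyticAt ℝ f 0) (n : ℕ) :
    taylorSeries (fun x => f x ^ n) = taylorSeries f ^ n := by
  induction n with
  | zero => simpa using const 1
  | succ n ih =>
    simp_rw [pow_succ]
    rw [mul (hf.fun_pow n) hf, ih]

theorem eval (p : ℝ[X]) : taylorSeries (fun x => p.eval x) = (p : PowerSeries ℝ) := by
  induction p using Polynomial.induction_on' with
  | add p q hp hq =>
    simp_rw [Polynomial.eval_add]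
    rw [add (AnalyticOnNhd.eval_polynomial p 0 trivial) (AnalyticOnNhd.eval_polynomial q 0 trivial), hp, hq, Polynomial.coe_add]
  | monomial n a =>
    simp_rw [Polynomial.eval_monomial]
    rw [const_mul, pow (f := fun x => x) analyticAt_id, id, ← Polynomial.C_mul_X_pow_eq_monomial, Polynomial.coe_mul,
      Polynomial.coe_pow, Polynomial.coe_X, Polynomial.coe_C, PowerSeries.smul_eq_C_mul]

theorem deriv (f : ℝ → ℝ) :
    taylorSeries (deriv f) = PowerSeries.derivative ℝ (taylorSeries f) := by
  ext k
  rw [PowerSeries.coeff_derivative, coeff_eq, coeff_eq, iteratedDeriv_succ', Nat.factorial_succ]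
  push_cast
  have := Nat.factorial_ne_zero k
  field_simp

/-- An analytic function whose Taylor coefficients of order `< N` vanish is divisible by `x ^ N`. -/
theorem exists_eq_pow_mul (hf : AnalyticAt ℝ f 0) {N : ℕ}
    (h : ∀ k < N, PowerSeries.coeff k (taylorSeries f) = 0) :
    ∃ g : ℝ → ℝ, AnalyticAt ℝ g 0 ∧ f =ᶠ[𝓝 0] fun x => x ^ N * g x := by
  have h' : (N : ℕ∞) ≤ analyticOrderAt f 0 := by
    rw [natCast_le_analyticOrderAt_iff_iteratedDeriv_eq_zero hf]
    intro i hi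
    have := h i hi
    rw [coeff_eq, div_eq_zero_iff] at this
    exact this.resolve_right (by exact_mod_cast Nat.factorial_ne_zero i)
  obtain ⟨g, hg, hfg⟩ := (natCast_le_analyticOrderAt hf).1 h'
  exact ⟨g, hg, by filter_upwards [hfg] with x hx; simpa using hx⟩

theorem isBigO_pow (hf : AnalyticAt ℝ f 0) {N : ℕ}
    (h : ∀ k < N, PowerSeries.coeff k (taylorSeries f) = 0) :
    f =O[𝓝 0] fun x => x ^ N := by
  obtain ⟨g, hg, hfg⟩ := exists_eq_pow_mul hf h
  refine hfg.trans_isBigO ?_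
  simpa using (isBigO_refl (fun x : ℝ => x ^ N) (𝓝 0)).mul (hg.continuousAt.isBigO_one ℝ)

/-- The Taylor coefficients of a composition with an inner polynomial without constant term. -/
theorem coeff_comp_eval {h : ℝ → ℝ} (hh : AnalyticAt ℝ h 0) {B : ℝ[X]} (hB : B.coeff 0 = 0)
    (k : ℕ) :
    PowerSeries.coeff k (taylorSeries fun x => h (B.eval x)) =
      ∑ j ∈ Finset.range (k + 1), PowerSeries.coeff j (taylorSeries h) * (B ^ j).coeff k := by
  -- Truncate `h` after order `k`. The remainder is `y^(k+1) g(y)`, and `y = B(x)` is divisible by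
  -- `x`, so it does not reach the coefficient of `x^k`.
  set p : ℝ[X] := ∑ j ∈ Finset.range (k + 1),
    Polynomial.C (PowerSeries.coeff j (taylorSeries h)) * Polynomial.X ^ j with hp
  have hpan : AnalyticAt ℝ (fun x => p.eval x) 0 := AnalyticOnNhd.eval_polynomial p 0 trivial
  have hBan : AnalyticAt ℝ (fun x => B.eval x) 0 := AnalyticOnNhd.eval_polynomial B 0 trivial
  have hB0 : B.eval 0 = 0 := by rwa [← Polynomial.coeff_zero_eq_eval_zero]
  obtain ⟨g, hg, hgeq⟩ := exists_eq_pow_mul (hh.fun_sub hpan) (N := k + 1) (by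
    intro i hi
    rw [sub hh hpan, map_sub, eval, Polynomial.coeff_coe, hp, Polynomial.finsetSum_coeff]
    simp [Polynomial.coeff_X_pow, hi])
  have hgB : AnalyticAt ℝ (fun x => g (B.eval x)) 0 :=
    AnalyticAt.fun_comp (g := g) (by rwa [hB0]) hBan
  have hcomp : (fun x => h (B.eval x)) =ᶠ[𝓝 0]
      fun x => (p.comp B).eval x + B.eval x ^ (k + 1) * g (B.eval x) := by
    have htend : Tendsto (fun x => B.eval x) (𝓝 0) (𝓝 0) := by
      simpa [hB0] using hBan.continuousAt.tendsto
    filter_upwards [htend.eventually hgeq] with x hx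
    rw [Polynomial.eval_comp]
    linarith
  have hcan : AnalyticAt ℝ (fun x => (p.comp B).eval x) 0 :=
    AnalyticOnNhd.eval_polynomial _ 0 trivial
  rw [congr hcomp, add hcan ((hBan.fun_pow _).fun_mul hgB), mul (hBan.fun_pow _) hgB, pow hBan,
    eval, eval, map_add, Polynomial.coeff_coe]
  have hX : (PowerSeries.X : PowerSeries ℝ) ∣ (B : PowerSeries ℝ) := by
    rw [PowerSeries.X_dvd_iff, Polynomial.constantCoeff_coe, hB]
  have h0 : PowerSeries.coeff k ((B : PowerSeries ℝ) ^ (k + 1) * taylorSeries fun x => g (B.eval x))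
      = 0 := by
    have := (pow_dvd_pow_of_dvd hX (k + 1)).mul_right (taylorSeries fun x => g (B.eval x))
    exact PowerSeries.X_pow_dvd_iff.1 this k (Nat.lt_succ_self k)
  rw [h0, add_zero, hp, Polynomial.sum_comp, Polynomial.finsetSum_coeff]
  simp

theorem analyticAt_one_add_rpow (α : ℝ) : AnalyticAt ℝ (fun x : ℝ => (1 + x) ^ α) 0 :=
  Real.one_add_rpow_hasFPowerSeriesAt_zero.analyticAt

theorem coeff_one_add_rpow (k : ℕ) (α : ℝ) :
    PowerSeries.coeff k (taylorSeries fun x => (1 + x) ^ α) = genBinom α k := by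
  -- Differentiation lowers the exponent by one, so the induction has to cover all `α`.
  induction k generalizing α with
  | zero => simp [genBinom, constantCoeff_eq]
  | succ k ih =>
    have hd : _root_.deriv (fun x : ℝ => (1 + x) ^ α) =ᶠ[𝓝 0] fun x => α * (1 + x) ^ (α - 1) := by
      filter_upwards [lt_mem_nhds (show (-1 : ℝ) < 0 by norm_num)] with x hx
      have h1 : (1 : ℝ) + x ≠ 0 := by linarith
      have := ((hasDerivAt_id x).const_add 1).rpow_const (p := α) (Or.inl h1)
      simpa using this.deriv
    have h1 := congrArg (PowerSeries.coeff k) (deriv fun x : ℝ => (1 + x) ^ α)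
    rw [congr hd, const_mul, map_smul, ih, PowerSeries.coeff_derivative] at h1
    have hk : (k : ℝ) + 1 ≠ 0 := by positivity
    rw [← mul_left_inj' hk, ← h1, genBinom, genBinom, Finset.prod_range_succ', Nat.factorial_succ]
    have := Nat.factorial_ne_zero k
    push_cast
    have : ∀ i : ℕ, α - (i + 1) = α - 1 - i := fun i => by ring
    simp only [this, smul_eq_mul]
    field_simp
    simp only [sub_zero]
    ring

theorem analyticAt_log_one_add : AnalyticAt ℝ (fun x : ℝ => Real.log (1 + x)) 0 := by
  refine AnalyticAt.log (by fun_prop) (by norm_num)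

theorem coeff_log_one_add (k : ℕ) :
    PowerSeries.coeff (k + 1) (taylorSeries fun x => Real.log (1 + x)) =
      (-1) ^ (k + 2) / ((k + 1 : ℕ) : ℝ) := by
  have hd : _root_.deriv (fun x : ℝ => Real.log (1 + x)) =ᶠ[𝓝 0] fun x => (1 + x) ^ (-1 : ℝ) := by
    filter_upwards [lt_mem_nhds (show (-1 : ℝ) < 0 by norm_num)] with x hx
    have h1 : (1 : ℝ) + x ≠ 0 := by linarith
    have := ((hasDerivAt_id x).const_add 1).log h1
    rw [Real.rpow_neg_one]
    simpa using this.deriv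
  have h1 := congrArg (PowerSeries.coeff k) (deriv fun x : ℝ => Real.log (1 + x))
  rw [congr hd, coeff_one_add_rpow, PowerSeries.coeff_derivative] at h1
  have hg : ∀ k : ℕ, genBinom (-1) k = (-1) ^ k := by
    intro k
    rw [genBinom, div_eq_iff (by exact_mod_cast Nat.factorial_ne_zero k)]
    induction k with
    | zero => simp
    | succ k ih => rw [Finset.prod_range_succ, ih, Nat.factorial_succ]; push_cast; ring
  rw [hg] at h1
  have hk : (k : ℝ) + 1 ≠ 0 := by positivity
  push_cast
  rw [eq_div_iff hk, ← h1]
  ring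

end taylorSeries

theorem coeff_taylorSeries_one_add_rpow {B : ℝ[X]} (hB : B.coeff 0 = 0) (α : ℝ) (k : ℕ) :
    PowerSeries.coeff k (taylorSeries fun x => (1 + B.eval x) ^ α) = powCoeff B α k := by
  rw [taylorSeries.coeff_comp_eval (taylorSeries.analyticAt_one_add_rpow α) hB, powCoeff]
  simp_rw [taylorSeries.coeff_one_add_rpow]

theorem coeff_taylorSeries_log_one_add {B : ℝ[X]} (hB : B.coeff 0 = 0) (k : ℕ) :
    PowerSeries.coeff k (taylorSeries fun x => Real.log (1 + B.eval x)) = logCoeff B k := by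
  rw [taylorSeries.coeff_comp_eval taylorSeries.analyticAt_log_one_add hB, logCoeff,
    Finset.sum_range_succ', PowerSeries.coeff_zero_eq_constantCoeff_apply,
    taylorSeries.constantCoeff_eq, add_zero, Real.log_one, zero_mul, add_zero,
    ← Finset.Ico_add_one_right_eq_Icc, Finset.sum_Ico_eq_sum_range]
  refine Finset.sum_congr rfl fun j _ => ?_
  rw [taylorSeries.coeff_log_one_add, add_comm 1 j]

/-- The formal power series `(1 + B) ^ α`. -/
noncomputable def rpowSeries (B : ℝ[X]) (α : ℝ) : PowerSeries ℝ :=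
  taylorSeries fun x => (1 + B.eval x) ^ α

/-- The formal power series `log (1 + B)`. -/
noncomputable def logSeries (B : ℝ[X]) : PowerSeries ℝ :=
  taylorSeries fun x => Real.log (1 + B.eval x)

/-! ### The series `(1 + B)^α` and Lagrange inversion -/

section Series

variable {B : ℝ[X]}

theorem analyticAt_eval (B : ℝ[X]) (x : ℝ) : AnalyticAt ℝ (fun x => B.eval x) x :=
  AnalyticOnNhd.eval_polynomial B x trivial

theorem eval_zero_of_coeff_zero (hB : B.coeff 0 = 0) : B.eval 0 = 0 := by
  rwa [← Polynomial.coeff_zero_eq_eval_zero]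

theorem analyticAt_one_add_eval_rpow (hB : B.coeff 0 = 0) (α : ℝ) :
    AnalyticAt ℝ (fun x => (1 + B.eval x) ^ α) 0 :=
  AnalyticAt.fun_comp (g := fun y => (1 + y) ^ α)
    (by rw [eval_zero_of_coeff_zero hB]; exact taylorSeries.analyticAt_one_add_rpow α)
    (analyticAt_eval B 0)

theorem analyticAt_log_one_add_eval (hB : B.coeff 0 = 0) :
    AnalyticAt ℝ (fun x => Real.log (1 + B.eval x)) 0 :=
  AnalyticAt.fun_comp (g := fun y => Real.log (1 + y))
    (by rw [eval_zero_of_coeff_zero hB]; exact taylorSeries.analyticAt_log_one_add)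
    (analyticAt_eval B 0)

theorem eventually_one_add_eval_pos (hB : B.coeff 0 = 0) : ∀ᶠ x in 𝓝 (0 : ℝ), 0 < 1 + B.eval x := by
  have h : ContinuousAt (fun x => 1 + B.eval x) 0 := by fun_prop
  refine h.eventually_const_lt ?_
  beta_reduce
  rw [eval_zero_of_coeff_zero hB]
  norm_num

theorem rpowSeries_mul (hB : B.coeff 0 = 0) (α β : ℝ) :
    rpowSeries B α * rpowSeries B β = rpowSeries B (α + β) := by
  rw [rpowSeries, rpowSeries, ← taylorSeries.mul (analyticAt_one_add_eval_rpow hB α)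
    (analyticAt_one_add_eval_rpow hB β)]
  refine taylorSeries.congr ?_
  filter_upwards [eventually_one_add_eval_pos hB] with x hx
  rw [Real.rpow_add hx]

theorem rpowSeries_zero : rpowSeries B 0 = 1 := by
  simpa [rpowSeries] using taylorSeries.const 1

theorem rpowSeries_one : rpowSeries B 1 = 1 + B := by
  simp only [rpowSeries, Real.rpow_one]
  rw [taylorSeries.add analyticAt_const (analyticAt_eval B 0), taylorSeries.eval,
    taylorSeries.const, map_one]

theorem constantCoeff_rpowSeries (hB : B.coeff 0 = 0) (α : ℝ) :
    PowerSeries.constantCoeff (rpowSeries B α) = 1 := by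
  rw [rpowSeries, taylorSeries.constantCoeff_eq, eval_zero_of_coeff_zero hB]
  simp

open PowerSeries in
theorem derivative_rpowSeries (hB : B.coeff 0 = 0) (α : ℝ) :
    d⁄dX ℝ (rpowSeries B α) = C α * (rpowSeries B (α - 1) * d⁄dX ℝ (B : PowerSeries ℝ)) := by
  have hd : deriv (fun x : ℝ => (1 + B.eval x) ^ α) =ᶠ[𝓝 0]
      fun x => α * ((1 + B.eval x) ^ (α - 1) * (Polynomial.derivative B).eval x) := by
    filter_upwards [eventually_one_add_eval_pos hB] with x hx
    rw [(((B.hasDerivAt x).const_add 1).rpow_const (p := α) (Or.inl hx.ne')).deriv]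
    ring
  rw [rpowSeries, ← taylorSeries.deriv, taylorSeries.congr hd, taylorSeries.const_mul,
    taylorSeries.mul (analyticAt_one_add_eval_rpow hB _) (analyticAt_eval _ 0),
    taylorSeries.eval, derivative_coe, smul_eq_C_mul]
  rfl

open PowerSeries in
theorem derivative_logSeries (hB : B.coeff 0 = 0) :
    d⁄dX ℝ (logSeries B) = rpowSeries B (-1) * d⁄dX ℝ (B : PowerSeries ℝ) := by
  have hd : deriv (fun x : ℝ => Real.log (1 + B.eval x)) =ᶠ[𝓝 0]
      fun x => (1 + B.eval x) ^ (-1 : ℝ) * (Polynomial.derivative B).eval x := by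
    filter_upwards [eventually_one_add_eval_pos hB] with x hx
    rw [(((B.hasDerivAt x).const_add 1).log hx.ne').deriv, Real.rpow_neg_one, div_eq_inv_mul]
  rw [logSeries, ← taylorSeries.deriv, taylorSeries.congr hd,
    taylorSeries.mul (analyticAt_one_add_eval_rpow hB _) (analyticAt_eval _ 0),
    taylorSeries.eval, derivative_coe]
  rfl

open PowerSeries

theorem coeff_X_mul_derivative (F : PowerSeries ℝ) (k : ℕ) :
    coeff k (X * d⁄dX ℝ F) = k * coeff k F := by
  cases k with
  | zero => simp
  | succ k => rw [coeff_succ_X_mul, coeff_derivative]; push_cast; ring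

/-- The functional `H ↦ [t^k] t H'(t) (1 + B(t))^(k/m)`. Up to the factor `k` it extracts, by
Lagrange inversion, the coefficient of `y^k` of `H` expanded in `y = t (1 + B(t))^(-1/m)`. -/
noncomputable def lagrangeCoeff (B : ℝ[X]) (m : ℝ) (k : ℕ) (H : PowerSeries ℝ) : ℝ :=
  coeff k (X * d⁄dX ℝ H * rpowSeries B (k / m))

theorem lagrangeCoeff_sub (m : ℝ) (k : ℕ) (H K : PowerSeries ℝ) :
    lagrangeCoeff B m k (H - K) = lagrangeCoeff B m k H - lagrangeCoeff B m k K := by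
  simp [lagrangeCoeff, mul_sub, sub_mul]

theorem lagrangeCoeff_C_mul (m : ℝ) (k : ℕ) (c : ℝ) (H : PowerSeries ℝ) :
    lagrangeCoeff B m k (C c * H) = c * lagrangeCoeff B m k H := by
  rw [lagrangeCoeff, lagrangeCoeff, Derivation.leibniz, derivative_C, smul_zero, add_zero, smul_eq_mul,
    mul_left_comm, mul_assoc, coeff_C_mul]

theorem lagrangeCoeff_sum {ι : Type*} (s : Finset ι) (m : ℝ) (k : ℕ) (H : ι → PowerSeries ℝ) :
    lagrangeCoeff B m k (∑ i ∈ s, H i) = ∑ i ∈ s, lagrangeCoeff B m k (H i) := by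
  simp [lagrangeCoeff, Finset.mul_sum, Finset.sum_mul]

/-- Biorthogonality of the functionals with the powers of `y = t A^(-1/m)`, where `A = 1 + B`. For
`j < k` the two contributions are multiples of `[t^(k-j)] A^((k-j)/m)`, the second via `t` times the
derivative of that power, and they cancel. -/
theorem lagrangeCoeff_basis (hB : B.coeff 0 = 0) {m : ℝ} (hm : m ≠ 0) {j k : ℕ} (hj : j ≠ 0)
    (hk : k ≠ 0) :
    lagrangeCoeff B m k (X ^ j * rpowSeries B (-(j / m))) = if j = k then (k : ℝ) else 0 := by
  have hXd : X * d⁄dX ℝ (X ^ j * rpowSeries B (-(j / m))) * rpowSeries B (k / m) =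
      X ^ j * (C (j : ℝ) * rpowSeries B ((k - j) / m) -
        C (j / m : ℝ) * (X * (rpowSeries B ((k - j) / m - 1) * d⁄dX ℝ (B : PowerSeries ℝ)))) := by
    have h1 : rpowSeries B ((k - j) / m) = rpowSeries B (-(j / m)) * rpowSeries B (k / m) := by
      rw [rpowSeries_mul hB]; congr 1; ring
    have h2 : rpowSeries B ((k - j) / m - 1) =
        rpowSeries B (-(j / m) - 1) * rpowSeries B (k / m) := by
      rw [rpowSeries_mul hB]; congr 1; ring
    obtain ⟨i, rfl⟩ := Nat.exists_eq_succ_of_ne_zero hj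
    rw [Derivation.leibniz, derivative_rpowSeries hB, h1, h2, derivative_pow, derivative_X, map_neg]
    simp only [smul_eq_mul, map_natCast, Nat.succ_eq_add_one, Nat.add_sub_cancel]
    ring
  rw [lagrangeCoeff, hXd, coeff_X_pow_mul']
  split_ifs with h1 h2 h2
  · subst h2
    simp [constantCoeff_rpowSeries hB]
  · have hlt : j < k := lt_of_le_of_ne h1 h2
    have hd : ((k : ℝ) - j) / m ≠ 0 := by
      have : (j : ℝ) < k := by exact_mod_cast hlt
      exact div_ne_zero (by linarith) hm
    have h3 : X * (rpowSeries B ((k - j) / m - 1) * d⁄dX ℝ (B : PowerSeries ℝ)) =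
        C ((((k : ℝ) - j) / m)⁻¹) * (X * d⁄dX ℝ (rpowSeries B ((k - j) / m))) := by
      rw [derivative_rpowSeries hB, mul_left_comm X (C _), ← mul_assoc (C _) (C _), ← map_mul,
        inv_mul_cancel₀ hd, map_one, one_mul]
    rw [h3, map_sub, coeff_C_mul, coeff_C_mul, coeff_C_mul, coeff_X_mul_derivative,
      Nat.cast_sub h1]
    have : (k : ℝ) - j ≠ 0 := fun h => hd (by rw [h, zero_div])
    field_simp
    ring
  · omega
  · rfl

/-- Triangularity: on a series of order at least `k`, only the constant term 1 of `(1 + B)^(k/m)`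
contributes. -/
theorem lagrangeCoeff_of_coeff_eq_zero (hB : B.coeff 0 = 0) (m : ℝ) {k : ℕ} {H : PowerSeries ℝ}
    (h : ∀ i < k, coeff i H = 0) : lagrangeCoeff B m k H = k * coeff k H := by
  rw [lagrangeCoeff, coeff_mul, Finset.sum_eq_single (k, 0)]
  · rw [coeff_X_mul_derivative, coeff_zero_eq_constantCoeff_apply, constantCoeff_rpowSeries hB,
      mul_one]
  · rintro ⟨i, j⟩ hij hne
    replace hij : i + j = k := Finset.HasAntidiagonal.mem_antidiagonal.1 hij
    have hi : i < k := by
      rcases Nat.eq_zero_or_pos j with rfl | hj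
      · exact absurd (by simpa using hij) (by simpa using hne)
      · omega
    rw [coeff_X_mul_derivative, h i hi, mul_zero, zero_mul]
  · simp

/-- Lagrange inversion: expansion in powers of `X * (1 + B) ^ (-1 / m)`. -/
theorem coeff_sub_lagrange_expansion (hB : B.coeff 0 = 0) {m : ℝ} (hm : m ≠ 0) {N : ℕ}
    {H : PowerSeries ℝ} (hH : constantCoeff H = 0) {k : ℕ} (hk : k < N + 1) :
    coeff k (H - ∑ j ∈ Finset.Icc 1 N, C (lagrangeCoeff B m j H / j) *
      (X ^ j * rpowSeries B (-(j / m)))) = 0 := by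
  induction k using Nat.strong_induction_on with
  | _ k ih =>
    rcases Nat.eq_zero_or_pos k with rfl | hpos
    · rw [coeff_zero_eq_constantCoeff_apply, map_sub, hH, map_sum, zero_sub, neg_eq_zero]
      refine Finset.sum_eq_zero fun j hj => ?_
      have : j ≠ 0 := by have := (Finset.mem_Icc.1 hj).1; omega
      simp [this]
    -- The remainder vanishes below order `k`, so its `k`-th functional is `k` times its `k`-th
    -- coefficient; biorthogonality makes that functional zero.
    · have h := lagrangeCoeff_of_coeff_eq_zero hB m (fun i hi => ih i hi (by omega))
      have hk0 : (k : ℝ) ≠ 0 := by exact_mod_cast hpos.ne'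
      rw [lagrangeCoeff_sub, lagrangeCoeff_sum, Finset.sum_eq_single k] at h
      · rw [lagrangeCoeff_C_mul, lagrangeCoeff_basis hB hm hpos.ne' hpos.ne', if_pos rfl,
          div_mul_cancel₀ _ hk0, sub_self] at h
        exact (mul_eq_zero.1 h.symm).resolve_left hk0
      · intro j hj hne
        have : j ≠ 0 := by have := (Finset.mem_Icc.1 hj).1; omega
        rw [lagrangeCoeff_C_mul, lagrangeCoeff_basis hB hm this hpos.ne', if_neg hne, mul_zero]
      · intro hnot
        exact absurd (Finset.mem_Icc.2 ⟨hpos, by omega⟩) hnot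

end Series

/-! ### Lagrange coefficients of the saddle point exponent -/

section Saddle

open PowerSeries

/-- `∑_{s ∈ S} t^(m - s) / s`. -/
noncomputable def revPotential (S : Finset ℕ) (m : ℕ) : ℝ[X] :=
  ∑ s ∈ S, Polynomial.C (1 / (s : ℝ)) * Polynomial.X ^ (m - s)

/-- The Taylor series of the normalised logarithm of the saddle point value. -/
noncomputable def saddleSeries (S : Finset ℕ) (m : ℕ) : PowerSeries ℝ :=
  revPotential S m * rpowSeries (revTail S m) (-1) + C (1 / (m : ℝ)) * logSeries (revTail S m) -
    C (1 / (m : ℝ))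

variable {S : Finset ℕ} {m : ℕ}

theorem lt_of_mem_erase_of_isGreatest (hm : IsGreatest (S : Set ℕ) m) {s : ℕ}
    (hs : s ∈ S.erase m) : s < m :=
  lt_of_le_of_ne (hm.2 (Finset.mem_of_mem_erase hs)) (Finset.ne_of_mem_erase hs)

theorem coeff_zero_revTail (hm : IsGreatest (S : Set ℕ) m) : (revTail S m).coeff 0 = 0 := by
  rw [revTail, Polynomial.finsetSum_coeff]
  refine Finset.sum_eq_zero fun s hs => ?_
  have := lt_of_mem_erase_of_isGreatest hm hs
  rw [Polynomial.coeff_X_pow, if_neg (by omega)]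

theorem one_add_revTail (hm : IsGreatest (S : Set ℕ) m) :
    1 + revTail S m = ∑ s ∈ S, Polynomial.X ^ (m - s) := by
  rw [← Finset.add_sum_erase S _ hm.1, revTail]
  simp

/-- Termwise this is `(m - s)/s = m/s - 1`. -/
theorem X_mul_derivative_revPotential (hpos : ∀ s ∈ S, 0 < s) (hm : IsGreatest (S : Set ℕ) m) :
    X * d⁄dX ℝ (revPotential S m : PowerSeries ℝ) =
      C (m : ℝ) * (revPotential S m : PowerSeries ℝ) - (1 + (revTail S m : PowerSeries ℝ)) := by
  rw [← Polynomial.coe_one, ← Polynomial.coe_add, one_add_revTail hm, derivative_coe]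
  ext k
  rw [← derivative_coe, coeff_X_mul_derivative, map_sub, coeff_C_mul, Polynomial.coeff_coe,
    Polynomial.coeff_coe, revPotential, Polynomial.finsetSum_coeff, Polynomial.finsetSum_coeff,
    Finset.mul_sum, Finset.mul_sum, ← Finset.sum_sub_distrib]
  refine Finset.sum_congr rfl fun s hs => ?_
  have hs0 : (s : ℝ) ≠ 0 := by exact_mod_cast (hpos s hs).ne'
  rw [Polynomial.coeff_C_mul, Polynomial.coeff_X_pow]
  split_ifs with h
  · subst h
    rw [Nat.cast_sub (hm.2 hs)]
    field_simp
  · simp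

theorem coeff_revPotential_self (hpos : ∀ s ∈ S, 0 < s) (hm : IsGreatest (S : Set ℕ) m) :
    (revPotential S m).coeff m = 0 := by
  rw [revPotential, Polynomial.finsetSum_coeff]
  refine Finset.sum_eq_zero fun s hs => ?_
  have h1 := hpos s hs
  have h2 := hm.2 hs
  rw [Polynomial.coeff_C_mul, Polynomial.coeff_X_pow, if_neg (by omega), mul_zero]

theorem coeff_revTail_self (hpos : ∀ s ∈ S, 0 < s) (hm : IsGreatest (S : Set ℕ) m) :
    (revTail S m).coeff m = 0 := by
  rw [revTail, Polynomial.finsetSum_coeff]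
  refine Finset.sum_eq_zero fun s hs => ?_
  have h1 := hpos s (Finset.mem_of_mem_erase hs)
  have h2 := lt_of_mem_erase_of_isGreatest hm hs
  rw [Polynomial.coeff_X_pow, if_neg (by omega)]

theorem coeff_zero_revPotential (hm : IsGreatest (S : Set ℕ) m) :
    (revPotential S m).coeff 0 = 1 / (m : ℝ) := by
  rw [revPotential, Polynomial.finsetSum_coeff, Finset.sum_eq_single m]
  · simp
  · intro s hs hne
    have := lt_of_le_of_ne (hm.2 hs) hne
    rw [Polynomial.coeff_C_mul, Polynomial.coeff_X_pow, if_neg (by omega), mul_zero]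
  · exact fun h => absurd hm.1 h

theorem constantCoeff_saddleSeries (hm : IsGreatest (S : Set ℕ) m) :
    constantCoeff (saddleSeries S m) = 0 := by
  have h := coeff_zero_revTail hm
  rw [saddleSeries, logSeries]
  simp [constantCoeff_rpowSeries h, taylorSeries.constantCoeff_eq, eval_zero_of_coeff_zero h,
    Polynomial.constantCoeff_coe, coeff_zero_revPotential hm]

theorem X_mul_derivative_saddleSeries (hpos : ∀ s ∈ S, 0 < s) (hm : IsGreatest (S : Set ℕ) m)
    (α : ℝ) :
    X * d⁄dX ℝ (saddleSeries S m) * rpowSeries (revTail S m) α =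
      C (m : ℝ) * ((revPotential S m : PowerSeries ℝ) * rpowSeries (revTail S m) (α - 1)) -
      rpowSeries (revTail S m) α -
      (revPotential S m : PowerSeries ℝ) * (X * (rpowSeries (revTail S m) (α - 2) *
        d⁄dX ℝ (revTail S m : PowerSeries ℝ))) +
      C (1 / (m : ℝ)) * (X * (rpowSeries (revTail S m) (α - 1) *
        d⁄dX ℝ (revTail S m : PowerSeries ℝ))) := by
  have hB := coeff_zero_revTail hm
  have h1 : rpowSeries (revTail S m) (α - 1) =
      rpowSeries (revTail S m) (-1) * rpowSeries (revTail S m) α := by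
    rw [rpowSeries_mul hB]; congr 1; ring
  have h2 : rpowSeries (revTail S m) (α - 2) =
      rpowSeries (revTail S m) (-1 - 1) * rpowSeries (revTail S m) α := by
    rw [rpowSeries_mul hB]; congr 1; ring
  have h3 : rpowSeries (revTail S m) 1 * rpowSeries (revTail S m) (-1) = 1 := by
    rw [rpowSeries_mul hB, add_neg_cancel, rpowSeries_zero]
  have h4 := X_mul_derivative_revPotential hpos hm
  rw [← rpowSeries_one] at h4
  rw [saddleSeries, map_sub, map_add, Derivation.leibniz, Derivation.leibniz, derivative_C,
    derivative_rpowSeries hB, derivative_logSeries hB, h1, h2]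
  simp only [smul_eq_mul, map_neg, map_one, sub_zero]
  linear_combination (rpowSeries (revTail S m) (-1) * rpowSeries (revTail S m) α) * h4 -
    rpowSeries (revTail S m) α * h3

/-- With `κ = k/m`, `A = 1 + B` and `Q` the potential, every term reduces to `[t^k] Q A^(κ-1)` or
`[t^k] A^κ`. The former has total factor `m - (k - m)/(κ - 1) = 0`, so `Q` drops out; the latter has
factor `-1/(κ - 1) = m/(m - k)`. -/
theorem lagrangeCoeff_saddleSeries_of_lt (hpos : ∀ s ∈ S, 0 < s) (hm : IsGreatest (S : Set ℕ) m)
    {k : ℕ} (hk : 0 < k) (hkm : k < m) :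
    lagrangeCoeff (revTail S m) m k (saddleSeries S m) =
      m / (m - k) * powCoeff (revTail S m) (k / m) k := by
  have hB := coeff_zero_revTail hm
  set κ : ℝ := k / m with hκ
  have hm0 : (m : ℝ) ≠ 0 := by exact_mod_cast (hk.trans hkm).ne'
  have hk0 : (k : ℝ) ≠ 0 := by exact_mod_cast hk.ne'
  have hmk : (m : ℝ) - k ≠ 0 := by
    have : (k : ℝ) < m := by exact_mod_cast hkm
    exact sub_ne_zero.2 this.ne'
  have hκ0 : κ ≠ 0 := div_ne_zero hk0 hm0
  have hκ1 : κ - 1 ≠ 0 := by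
    rw [hκ, div_sub_one hm0]
    exact div_ne_zero (by rw [← neg_sub]; exact neg_ne_zero.2 hmk) hm0
  have h3 : rpowSeries (revTail S m) 1 * rpowSeries (revTail S m) (κ - 1) =
      rpowSeries (revTail S m) κ := by
    rw [rpowSeries_mul hB]; congr 1; ring
  have h4 := X_mul_derivative_revPotential hpos hm
  rw [← rpowSeries_one] at h4
  set M : PowerSeries ℝ := (revPotential S m : PowerSeries ℝ) * rpowSeries (revTail S m) (κ - 1) with hM
  have hXM : C (κ - 1) * ((revPotential S m : PowerSeries ℝ) * (X * (rpowSeries (revTail S m) (κ - 2) *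
      d⁄dX ℝ (revTail S m : PowerSeries ℝ)))) =
      X * d⁄dX ℝ M - C (m : ℝ) * M + rpowSeries (revTail S m) κ := by
    rw [hM, Derivation.leibniz, derivative_rpowSeries hB, show κ - 1 - 1 = κ - 2 by ring]
    simp only [smul_eq_mul]
    linear_combination (-rpowSeries (revTail S m) (κ - 1)) * h4 + h3
  have hXe : C κ * (X * (rpowSeries (revTail S m) (κ - 1) *
      d⁄dX ℝ (revTail S m : PowerSeries ℝ))) = X * d⁄dX ℝ (rpowSeries (revTail S m) κ) := by
    rw [derivative_rpowSeries hB]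
    ring
  have c1 := congrArg (coeff k) hXM
  have c2 := congrArg (coeff k) hXe
  rw [coeff_C_mul, map_add, map_sub, coeff_X_mul_derivative, coeff_C_mul] at c1
  rw [coeff_C_mul, coeff_X_mul_derivative] at c2
  rw [lagrangeCoeff, X_mul_derivative_saddleSeries hpos hm, ← hκ, ← hM, map_add, map_sub, map_sub,
    coeff_C_mul, coeff_C_mul, ← coeff_taylorSeries_one_add_rpow hB]
  change _ = _ * coeff k (rpowSeries (revTail S m) κ)
  rw [mul_comm, ← eq_div_iff hκ1] at c1
  rw [mul_comm, ← eq_div_iff hκ0] at c2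
  rw [c1, c2, hκ, div_sub_one hm0]
  have hkm' : (k : ℝ) - m ≠ 0 := by rw [← neg_sub]; exact neg_ne_zero.2 hmk
  field_simp
  ring

/-- Division by `κ - 1` is impossible at `k = m`. Instead `Q`, `A` and `t A'` have no `t^m` term
because every `s` is positive, leaving `-[t^m] Q · t (log A)'`; the factor `1/s` in `Q` cancels the
`s` produced by differentiation. -/
theorem lagrangeCoeff_saddleSeries_self (hpos : ∀ s ∈ S, 0 < s) (hm : IsGreatest (S : Set ℕ) m) :
    lagrangeCoeff (revTail S m) m m (saddleSeries S m) =
      -∑ s ∈ S, logCoeff (revTail S m) s := by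
  have hB := coeff_zero_revTail hm
  have hm1 : 0 < m := hpos m hm.1
  have hm0 : (m : ℝ) ≠ 0 := by exact_mod_cast hm1.ne'
  rw [lagrangeCoeff, X_mul_derivative_saddleSeries hpos hm, div_self hm0, sub_self, rpowSeries_zero,
    mul_one, one_mul, show (1 : ℝ) - 2 = -1 by norm_num, ← derivative_logSeries hB, rpowSeries_one,
    map_add, map_sub, map_sub, coeff_C_mul, coeff_C_mul, coeff_X_mul_derivative, map_add,
    Polynomial.coeff_coe, Polynomial.coeff_coe, coeff_revPotential_self hpos hm,
    coeff_revTail_self hpos hm, coeff_one, if_neg hm1.ne', mul_zero, mul_zero, add_zero,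
    add_zero, sub_zero, zero_sub, neg_inj, revPotential]
  rw [← Polynomial.coeToPowerSeries.ringHom_apply, map_sum, Finset.sum_mul, map_sum]
  refine Finset.sum_congr rfl fun s hs => ?_
  have hs0 : (s : ℝ) ≠ 0 := by exact_mod_cast (hpos s hs).ne'
  rw [Polynomial.coeToPowerSeries.ringHom_apply, Polynomial.coe_mul, Polynomial.coe_pow,
    Polynomial.coe_C, Polynomial.coe_X, mul_assoc, coeff_C_mul, coeff_X_pow_mul',
    if_pos (Nat.sub_le _ _), Nat.sub_sub_self (hm.2 hs), coeff_X_mul_derivative, logSeries,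
    coeff_taylorSeries_log_one_add hB]
  field_simp

/-- The formal Lagrange expansion becomes a bound on functions. Order `m + 1` is what is needed,
since the bound will be multiplied by `n ~ w^(-m)`. -/
theorem saddle_isBigO (hpos : ∀ s ∈ S, 0 < s) (hm : IsGreatest (S : Set ℕ) m) :
    (fun w : ℝ => (revPotential S m).eval w * (1 + (revTail S m).eval w) ^ (-1 : ℝ) +
        1 / m * Real.log (1 + (revTail S m).eval w) - 1 / m -
        ∑ k ∈ Finset.Icc 1 m, lagrangeCoeff (revTail S m) m k (saddleSeries S m) / k *
          (w ^ k * (1 + (revTail S m).eval w) ^ (-((k : ℝ) / m))))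
      =O[𝓝 0] fun w => w ^ (m + 1) := by
  have hB := coeff_zero_revTail hm
  have hm0 : (m : ℝ) ≠ 0 := by exact_mod_cast (hpos m hm.1).ne'
  have hr := analyticAt_one_add_eval_rpow hB
  have hl := analyticAt_log_one_add_eval hB
  have hQ := analyticAt_eval (revPotential S m) 0
  have h1 := (((hQ.fun_mul (hr (-1))).fun_add
    ((analyticAt_const (v := (1 / m : ℝ))).fun_mul hl)).fun_sub
      (analyticAt_const (v := (1 / m : ℝ))))
  have h2' : ∀ k ∈ Finset.Icc 1 m, AnalyticAt ℝ (fun w : ℝ =>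
      lagrangeCoeff (revTail S m) m k (saddleSeries S m) / k *
          (w ^ k * (1 + (revTail S m).eval w) ^ (-((k : ℝ) / m)))) 0 := fun k _ =>
    analyticAt_const.fun_mul ((analyticAt_id.fun_pow k).fun_mul (hr _))
  have h2 := Finset.analyticAt_fun_sum _ h2'
  refine taylorSeries.isBigO_pow (h1.fun_sub h2) fun k hk => ?_
  rw [← coeff_sub_lagrange_expansion hB hm0 (constantCoeff_saddleSeries hm) hk,
    taylorSeries.sub h1 h2, taylorSeries.sub ((hQ.fun_mul (hr (-1))).fun_add
    ((analyticAt_const (v := (1 / m : ℝ))).fun_mul hl)) analyticAt_const,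
    taylorSeries.add (hQ.fun_mul (hr (-1))) ((analyticAt_const (v := (1 / m : ℝ))).fun_mul hl),
    taylorSeries.mul hQ (hr _), taylorSeries.const_mul, taylorSeries.const, taylorSeries.eval,
    taylorSeries.sum _ _ h2', smul_eq_C_mul]
  congr 2
  refine Finset.sum_congr rfl fun j _ => ?_
  rw [taylorSeries.const_mul, taylorSeries.mul (f := fun w => w ^ j) (analyticAt_id.fun_pow j)
    (hr _), taylorSeries.pow (f := fun w => w) analyticAt_id, taylorSeries.id, smul_eq_C_mul]
  rfl

end Saddle

/-! ### The exponential formula -/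

section Combinatorics

theorem Multiset.filter_not_two_le_eq_replicate {s : Multiset ℕ} (h : ∀ i ∈ s, 0 < i) :
    s.filter (fun i => ¬ 2 ≤ i) = Multiset.replicate (s.count 1) 1 := by
  have h1 : s.filter (fun i => ¬ 2 ≤ i) = s.filter (fun i => i = 1) := by
    refine Multiset.filter_congr fun i hi => ?_
    have := h i hi
    omega
  rw [h1, Multiset.filter_eq']

/-- Cauchy's count of a conjugacy class. Cycle types omit fixed points, so the parts equal to 1 are
split off and contribute `c_1!`, where `c_1` is their number. -/
theorem Equiv.Perm.card_partition_eq_mul {α : Type*} [Fintype α] [DecidableEq α]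
    (p : (Fintype.card α).Partition) :
    (Finset.univ.filter fun σ : Equiv.Perm α => σ.partition = p).card *
      ∏ i ∈ p.parts.toFinset, (i ^ p.parts.count i * (p.parts.count i)!) =
      (Fintype.card α)! := by
  set m := p.parts.filter (fun i => 2 ≤ i) with hm
  have hsplit : m + Multiset.replicate (p.parts.count 1) 1 = p.parts := by
    rw [← Multiset.filter_not_two_le_eq_replicate fun i hi => p.parts_pos hi]
    exact Multiset.filter_add_not _ _
  have hsum : m.sum + p.parts.count 1 = Fintype.card α := by
    have := congrArg Multiset.sum hsplit
    rwa [Multiset.sum_add, Multiset.sum_replicate, p.parts_sum, smul_eq_mul, mul_one] at this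
  have hset : (Finset.univ.filter fun σ : Equiv.Perm α => σ.partition = p) =
      Finset.univ.filter fun σ : Equiv.Perm α => σ.cycleType = m := by
    ext σ
    simp only [Finset.mem_filter, Finset.mem_univ, true_and]
    constructor
    · rintro rfl
      rw [hm, Equiv.Perm.filter_parts_partition_eq_cycleType]
    · intro h
      have h1 : Fintype.card α - m.sum = p.parts.count 1 := by omega
      rw [Nat.Partition.ext_iff, Equiv.Perm.parts_partition, ← Equiv.Perm.sum_cycleType, h, h1,
        hsplit]
  have hcount : ∏ i ∈ p.parts.toFinset, (p.parts.count i)! =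
      (p.parts.count 1)! * ∏ i ∈ m.toFinset, (m.count i)! := by
    have h1 : (1 : ℕ) ∉ m.toFinset := by simp [hm]
    have h2 : ∏ i ∈ m.toFinset, (m.count i)! = ∏ i ∈ m.toFinset, (p.parts.count i)! := by
      refine Finset.prod_congr rfl fun i hi => ?_
      rw [hm, Multiset.count_filter, if_pos]
      exact (Multiset.mem_filter.1 (Multiset.mem_toFinset.1 hi)).2
    rw [h2, ← Finset.prod_insert h1 (f := fun i => (p.parts.count i)!)]
    refine Finset.prod_subset (fun i hi => ?_) fun i _ hi => ?_
    · rw [Multiset.mem_toFinset] at hi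
      have := p.parts_pos hi
      rw [Finset.mem_insert, Multiset.mem_toFinset, hm, Multiset.mem_filter]
      by_cases h : 2 ≤ i
      · exact Or.inr ⟨hi, h⟩
      · exact Or.inl (by omega)
    · rw [Multiset.count_eq_zero.2 fun h => hi (Multiset.mem_toFinset.2 h), Nat.factorial_zero]
  have hprod : ∏ i ∈ p.parts.toFinset, i ^ p.parts.count i = m.prod := by
    rw [← Finset.prod_multiset_count, ← hsplit, Multiset.prod_add, Multiset.prod_replicate,
      one_pow, mul_one]
  have key := Equiv.Perm.card_of_cycleType_mul_eq α m
  rw [if_pos ⟨by omega, fun a ha => (Multiset.mem_filter.1 ha).2⟩,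
    show Fintype.card α - m.sum = p.parts.count 1 by omega] at key
  rw [hset, Finset.prod_mul_distrib, hprod, hcount, ← key]
  ring

/-- The weight of `j` cycles of length `i` in the exponential formula. -/
noncomputable def cycleWeight (S : Finset ℕ) (i j : ℕ) : ℝ :=
  if i ∈ S then 1 / ((i : ℝ) ^ j * (j ! : ℝ)) else 0

/-- Group permutations by their partition: a class with `c_i` cycles of length `i` has probability
`∏ 1 / (i^{c_i} c_i!)`, and the weight 0 kills partitions with a part outside `S`. -/
theorem sPermProb_eq_coeff_genFun (S : Finset ℕ) (n : ℕ) :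
    sPermProb S n = PowerSeries.coeff n (Nat.Partition.genFun (cycleWeight S)) := by
  classical
  have h0 : PowerSeries.coeff n (Nat.Partition.genFun (cycleWeight S)) =
      PowerSeries.coeff (Fintype.card (Fin n)) (Nat.Partition.genFun (cycleWeight S)) := by
    rw [Fintype.card_fin]
  rw [h0, Nat.Partition.coeff_genFun, sPermProb, Nat.card_eq_fintype_card, Fintype.card_subtype,
    Finset.card_eq_sum_card_fiberwise (f := fun σ : Equiv.Perm (Fin n) => σ.partition)
      (t := Finset.univ) (by intro x _; simp), Nat.cast_sum, Finset.sum_div]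
  refine Finset.sum_congr rfl fun p _ => ?_
  rw [Finsupp.prod, Multiset.toFinsupp_support, Finset.filter_filter]
  by_cases hp : ∀ k ∈ p.parts, k ∈ S
  · have h1 : (Finset.univ.filter fun σ : Equiv.Perm (Fin n) =>
        IsSPermutation S σ ∧ σ.partition = p) =
        Finset.univ.filter fun σ : Equiv.Perm (Fin n) => σ.partition = p := by
      refine Finset.filter_congr fun σ _ => ?_
      constructor
      · exact fun h => h.2
      · rintro rfl
        exact ⟨hp, rfl⟩
    have h2 := Equiv.Perm.card_partition_eq_mul p
    replace h2 := h2.trans (congrArg Nat.factorial (Fintype.card_fin n))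
    have h3 : ∏ i ∈ p.parts.toFinset, cycleWeight S i (Multiset.toFinsupp p.parts i) =
        1 / ((∏ i ∈ p.parts.toFinset, (i ^ p.parts.count i * (p.parts.count i)!) : ℕ) : ℝ) := by
      rw [Nat.cast_prod, one_div, ← Finset.prod_inv_distrib]
      refine Finset.prod_congr rfl fun i hi => ?_
      rw [cycleWeight, if_pos (hp i (Multiset.mem_toFinset.1 hi)), Multiset.toFinsupp_apply]
      push_cast
      rw [one_div]
    rw [h1, h3, ← h2]
    have hne := Nat.factorial_ne_zero n
    rw [← h2] at hne
    have hne1 : ((Finset.univ.filter fun σ : Equiv.Perm (Fin n) => σ.partition = p).card : ℝ) ≠ 0 :=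
      by exact_mod_cast left_ne_zero_of_mul hne
    rw [Nat.cast_mul]
    field_simp
  · push Not at hp
    obtain ⟨k, hk, hkS⟩ := hp
    rw [Finset.filter_eq_empty_iff.2, Finset.prod_eq_zero (Multiset.mem_toFinset.2 hk)]
    · simp
    · rw [cycleWeight, if_neg hkS]
    · rintro σ _ ⟨h, rfl⟩
      exact hkS (h k hk)

/-- The power series `exp (X ^ s / s)`. -/
noncomputable def cycleSeries (s : ℕ) : PowerSeries ℝ :=
  PowerSeries.mk fun k => if s ∣ k then 1 / ((s : ℝ) ^ (k / s) * ((k / s)! : ℝ)) else 0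

open scoped PowerSeries.WithPiTopology in
theorem genFun_cycleWeight {S : Finset ℕ} (hpos : ∀ s ∈ S, 0 < s) :
    Nat.Partition.genFun (cycleWeight S) = ∏ s ∈ S, cycleSeries s := by
  have h1 := Nat.Partition.hasProd_genFun (cycleWeight S)
  have hin : ∀ s ∈ S, (1 : PowerSeries ℝ) + ∑' j, cycleWeight S s (j + 1) •
      (PowerSeries.X : PowerSeries ℝ) ^ (s * (j + 1)) = cycleSeries s := by
    intro s hs
    have hs0 := hpos s hs
    have : HasSum (fun j => cycleWeight S s (j + 1) •
        (PowerSeries.X : PowerSeries ℝ) ^ (s * (j + 1))) (cycleSeries s - 1) := by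
      rw [PowerSeries.WithPiTopology.hasSum_iff_hasSum_coeff]
      intro d
      rw [map_sub, cycleSeries, PowerSeries.coeff_mk, PowerSeries.coeff_one]
      simp only [map_smul, PowerSeries.coeff_X_pow, smul_eq_mul]
      by_cases hd : s ∣ d
      · obtain ⟨c, rfl⟩ := hd
        rw [if_pos (dvd_mul_right s c), Nat.mul_div_cancel_left _ hs0]
        rcases Nat.eq_zero_or_pos c with rfl | hc
        · convert hasSum_zero using 2
          · rw [if_neg (by positivity), mul_zero]
          · simp
        · convert hasSum_single (c - 1) _ using 1
          · rw [Nat.sub_add_cancel hc, if_pos rfl, if_neg (by positivity), cycleWeight, if_pos hs]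
            ring
          · intro j hj
            rw [if_neg, mul_zero]
            intro h
            have := Nat.eq_of_mul_eq_mul_left hs0 h
            omega
      · rw [if_neg hd, if_neg (by rintro rfl; exact hd (dvd_zero s)), sub_zero]
        convert hasSum_zero using 2 with j
        rw [if_neg, mul_zero]
        rintro rfl
        exact hd (dvd_mul_right _ _)
    rw [this.tsum_eq]
    ring
  -- In the infinite product the index `i` stands for part size `i + 1`; factors with `i + 1 ∉ S`
  -- are 1.
  have h2 := hasProd_prod_of_ne_finset_one (L := .unconditional ℕ) (s := S.image (· - 1))
    (f := fun i => (1 : PowerSeries ℝ) + ∑' j, cycleWeight S (i + 1) (j + 1) •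
      (PowerSeries.X : PowerSeries ℝ) ^ ((i + 1) * (j + 1))) (by
    intro i hi
    have : i + 1 ∉ S := fun h => hi (Finset.mem_image.2 ⟨i + 1, h, by simp⟩)
    simp [cycleWeight, this])
  rw [HasProd.unique h1 h2, Finset.prod_image]
  · refine Finset.prod_congr rfl fun s hs => ?_
    have hs0 := hpos s hs
    rw [Nat.sub_add_cancel hs0, hin s hs]
  · intro a ha b hb hab
    have h1 := hpos a ha
    have h2 := hpos b hb
    simp only at hab
    omega

/-- `F` is the power series of the entire function `f`. -/
def IsEntireSeries (F : PowerSeries ℝ) (f : ℂ → ℂ) : Prop :=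
  ∀ z : ℂ, (Summable fun n => ‖((PowerSeries.coeff n F : ℝ) : ℂ) * z ^ n‖) ∧
    HasSum (fun n => ((PowerSeries.coeff n F : ℝ) : ℂ) * z ^ n) (f z)

theorem IsEntireSeries.mul {F G : PowerSeries ℝ} {f g : ℂ → ℂ} (hF : IsEntireSeries F f)
    (hG : IsEntireSeries G g) : IsEntireSeries (F * G) (fun z => f z * g z) := by
  intro z
  have heq : (fun n => ((PowerSeries.coeff n (F * G) : ℝ) : ℂ) * z ^ n) = fun n =>
      ∑ kl ∈ Finset.HasAntidiagonal.antidiagonal n, (((PowerSeries.coeff kl.1 F : ℝ) : ℂ) * z ^ kl.1) *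
        (((PowerSeries.coeff kl.2 G : ℝ) : ℂ) * z ^ kl.2) := by
    ext n
    rw [PowerSeries.coeff_mul, Complex.ofReal_sum, Finset.sum_mul]
    refine Finset.sum_congr rfl fun kl h => ?_
    rw [← Finset.HasAntidiagonal.mem_antidiagonal.1 h, pow_add, Complex.ofReal_mul]
    ring
  have hs := summable_norm_sum_mul_antidiagonal_of_summable_norm (hF z).1 (hG z).1
  have ht := tsum_mul_tsum_eq_tsum_sum_antidiagonal_of_summable_norm (hF z).1 (hG z).1
  rw [(hF z).2.tsum_eq, (hG z).2.tsum_eq] at ht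
  refine ⟨?_, ?_⟩
  · convert hs using 2 with n
    exact congrArg norm (congrFun heq n)
  · beta_reduce
    rw [heq, ht]
    exact hs.of_norm.hasSum

theorem IsEntireSeries.prod {ι : Type*} (s : Finset ι) {F : ι → PowerSeries ℝ} {f : ι → ℂ → ℂ}
    (h : ∀ i ∈ s, IsEntireSeries (F i) (f i)) :
    IsEntireSeries (∏ i ∈ s, F i) (fun z => ∏ i ∈ s, f i z) := by
  classical
  induction s using Finset.induction_on with
  | empty =>
    intro z
    simp only [Finset.prod_empty, PowerSeries.coeff_one]
    have h0 : ∀ n ∉ ({0} : Finset ℕ), (((if n = 0 then 1 else 0 : ℝ) : ℂ) * z ^ n) = 0 := by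
      intro n hn
      rw [if_neg (by simpa using hn)]
      simp
    refine ⟨summable_of_ne_finset_zero (s := {0}) fun n hn => by rw [h0 n hn, norm_zero], ?_⟩
    simpa using hasSum_sum_of_ne_finset_zero h0
  | insert a s ha ih =>
    simp_rw [Finset.prod_insert ha]
    exact (h a (Finset.mem_insert_self a s)).mul
      (ih fun i hi => h i (Finset.mem_insert_of_mem hi))

theorem isEntireSeries_cycleSeries {s : ℕ} (hs : 0 < s) :
    IsEntireSeries (cycleSeries s) (fun z => Complex.exp (z ^ s / s)) := by
  intro z
  have hinj : Function.Injective fun j : ℕ => s * j := fun a b h => Nat.eq_of_mul_eq_mul_left hs h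
  have hzero : ∀ n ∉ Set.range (fun j : ℕ => s * j),
      ((PowerSeries.coeff n (cycleSeries s) : ℝ) : ℂ) * z ^ n = 0 := by
    intro n hn
    rw [cycleSeries, PowerSeries.coeff_mk, if_neg]
    · simp
    · rintro ⟨c, rfl⟩
      exact hn ⟨c, rfl⟩
  have hterm : ∀ j, ((PowerSeries.coeff (s * j) (cycleSeries s) : ℝ) : ℂ) * z ^ (s * j) =
      (z ^ s / s) ^ j / (j ! : ℂ) := by
    intro j
    rw [cycleSeries, PowerSeries.coeff_mk, if_pos (dvd_mul_right _ _), Nat.mul_div_cancel_left _ hs,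
      pow_mul, div_pow]
    push_cast
    ring
  refine ⟨?_, ?_⟩
  · rw [← hinj.summable_iff fun n hn => by rw [hzero n hn, norm_zero]]
    simp only [Function.comp_def, hterm]
    exact NormedSpace.norm_expSeries_div_summable (z ^ s / s : ℂ)
  · rw [← hinj.hasSum_iff hzero]
    simp only [Function.comp_def, hterm]
    rw [Complex.exp_eq_exp_ℂ]
    exact NormedSpace.expSeries_div_hasSum_exp (z ^ s / s : ℂ)

/-- The exponential formula: the generating function of `sPermProb S` is `exp (∑ z ^ s / s)`. -/
theorem isEntireSeries_sPermProb {S : Finset ℕ} (hpos : ∀ s ∈ S, 0 < s) (z : ℂ) :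
    (Summable fun n => ‖(sPermProb S n : ℂ) * z ^ n‖) ∧
      HasSum (fun n => (sPermProb S n : ℂ) * z ^ n) (Complex.exp (∑ s ∈ S, z ^ s / s)) := by
  have h := IsEntireSeries.prod S (fun s hs => isEntireSeries_cycleSeries (hpos s hs)) z
  rw [← genFun_cycleWeight hpos] at h
  simp_rw [← sPermProb_eq_coeff_genFun] at h
  rwa [Complex.exp_sum]

end Combinatorics

/-! ### Cauchy's formula and the saddle point integral -/

section SaddlePoint

open MeasureTheory Complex

theorem integral_exp_int_mul_I (k : ℤ) :
    ∫ θ in (-Real.pi)..Real.pi, Complex.exp ((k : ℂ) * I * (θ : ℂ)) =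
      if k = 0 then 2 * (Real.pi : ℂ) else 0 := by
  split_ifs with h
  · subst h
    simp
    ring
  · have hc : (k : ℂ) * I ≠ 0 := mul_ne_zero (by exact_mod_cast h) I_ne_zero
    rw [integral_exp_mul_complex hc, div_eq_zero_iff]
    left
    rw [sub_eq_zero, Complex.exp_eq_exp_iff_exists_int]
    refine ⟨k, ?_⟩
    push_cast
    ring

/-- Cauchy's coefficient formula for the generating function of `sPermProb S`. -/
theorem integral_exp_eq_sPermProb {S : Finset ℕ} (hpos : ∀ s ∈ S, 0 < s) (n : ℕ) (r : ℝ) :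
    ∫ θ in (-Real.pi)..Real.pi, Complex.exp (∑ s ∈ S, ((r : ℂ) * Complex.exp (θ * I)) ^ s / s -
      n * θ * I) = 2 * Real.pi * (sPermProb S n * (r : ℂ) ^ n) := by
  have hterm : ∀ (k : ℕ) (θ : ℝ), (sPermProb S k : ℂ) * ((r : ℂ) * Complex.exp (θ * I)) ^ k *
      Complex.exp (-(n * θ * I)) =
      (sPermProb S k : ℂ) * (r : ℂ) ^ k * Complex.exp (((k - n : ℤ) : ℂ) * I * θ) := by
    intro k θ
    rw [mul_pow, ← Complex.exp_nat_mul, ← mul_assoc, mul_assoc (_ * _), ← Complex.exp_add]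
    congr 2
    push_cast
    ring
  -- Termwise integration is allowed because `‖p_k r^k‖` is summable; orthogonality then keeps only
  -- `k = n`.
  have hsum := intervalIntegral.hasSum_integral_of_dominated_convergence (μ := volume)
    (a := -Real.pi) (b := Real.pi)
    (F := fun (k : ℕ) (θ : ℝ) => (sPermProb S k : ℂ) * ((r : ℂ) * Complex.exp (θ * I)) ^ k *
      Complex.exp (-(n * θ * I)))
    (f := fun θ : ℝ => Complex.exp (∑ s ∈ S, ((r : ℂ) * Complex.exp (θ * I)) ^ s / s - n * θ * I))
    (fun k _ => ‖(sPermProb S k : ℂ) * (r : ℂ) ^ k‖)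
    (fun k => Continuous.aestronglyMeasurable (by fun_prop))
    (fun k => Eventually.of_forall fun θ _ => by
      rw [hterm, norm_mul, Complex.norm_exp]
      simp)
    (Eventually.of_forall fun θ _ => (isEntireSeries_sPermProb hpos (r : ℂ)).1)
    (by simp)
    (Eventually.of_forall fun θ _ => by
      rw [sub_eq_add_neg, Complex.exp_add]
      exact (isEntireSeries_sPermProb hpos _).2.mul_right _)
  simp_rw [hterm, intervalIntegral.integral_const_mul, integral_exp_int_mul_I] at hsum
  refine hsum.unique ?_
  convert hasSum_single n _ using 1
  · simp
    ring
  · intro k hk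
    rw [if_neg (by omega), mul_zero]

/-- The exponent of the integrand at the saddle point. -/
noncomputable def saddleExponent (S : Finset ℕ) (r θ : ℝ) : ℂ :=
  ∑ s ∈ S, (r : ℂ) ^ s / s * (Complex.exp (s * θ * I) - 1 - s * θ * I)

theorem continuous_saddleExponent (S : Finset ℕ) (r : ℝ) : Continuous (saddleExponent S r) := by
  unfold saddleExponent
  fun_prop

/-- The saddle point equation makes the linear term of the exponent, `i θ ∑ r^s`, cancel `i n θ`. -/
theorem exp_mul_integral_saddleExponent {S : Finset ℕ} (hpos : ∀ s ∈ S, 0 < s) {n : ℕ} {r : ℝ}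
    (hr : ∑ s ∈ S, r ^ s = n) :
    Complex.exp (∑ s ∈ S, (r : ℂ) ^ s / s) *
      ∫ θ in (-Real.pi)..Real.pi, Complex.exp (saddleExponent S r θ) =
      2 * Real.pi * (sPermProb S n * (r : ℂ) ^ n) := by
  rw [← integral_exp_eq_sPermProb hpos, ← intervalIntegral.integral_const_mul]
  congr 1
  ext θ
  rw [← Complex.exp_add, saddleExponent, ← Finset.sum_add_distrib]
  congr 1
  have : (n : ℂ) = ∑ s ∈ S, (r : ℂ) ^ s := by
    rw [← Complex.ofReal_natCast, ← hr]
    push_cast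
    rfl
  rw [this, Finset.sum_mul, Finset.sum_mul, ← Finset.sum_sub_distrib]
  refine Finset.sum_congr rfl fun s hs => ?_
  have hs0 : (s : ℂ) ≠ 0 := by exact_mod_cast (hpos s hs).ne'
  rw [mul_pow, ← Complex.exp_nat_mul, ← mul_assoc]
  field_simp
  ring

theorem re_saddleExponent (S : Finset ℕ) (r θ : ℝ) :
    (saddleExponent S r θ).re = ∑ s ∈ S, r ^ s / s * (Real.cos (s * θ) - 1) := by
  rw [saddleExponent, Complex.re_sum]
  refine Finset.sum_congr rfl fun s _ => ?_
  have h1 : (r : ℂ) ^ s / s = ((r ^ s / s : ℝ) : ℂ) := by push_cast; rfl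
  have h2 : (s : ℂ) * θ * I = ((s * θ : ℝ) : ℂ) * I := by push_cast; rfl
  rw [h1, h2, Complex.re_ofReal_mul, Complex.sub_re, Complex.sub_re, Complex.exp_ofReal_mul_I_re]
  simp

/-- The variance at the saddle point. -/
noncomputable def saddleVar (S : Finset ℕ) (r : ℝ) : ℝ := ∑ s ∈ S, (s : ℝ) * r ^ s

variable {S : Finset ℕ} {m : ℕ}

theorem le_saddleVar (hpos : ∀ s ∈ S, 0 < s) (hm : IsGreatest (S : Set ℕ) m) {r : ℝ} (hr : 1 ≤ r) :
    r ≤ saddleVar S r := by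
  have hm0 := hpos m hm.1
  calc r ≤ r ^ m := le_self_pow₀ hr hm0.ne'
    _ ≤ m * r ^ m := le_mul_of_one_le_left (by positivity) (by exact_mod_cast hm0)
    _ ≤ saddleVar S r := Finset.single_le_sum (f := fun s : ℕ => (s : ℝ) * r ^ s)
        (fun s _ => by positivity) hm.1

theorem saddleVar_le (hm : IsGreatest (S : Set ℕ) m) {r : ℝ} (hr : 1 ≤ r) :
    saddleVar S r ≤ (∑ s ∈ S, (s : ℝ)) * r ^ m := by
  rw [saddleVar, Finset.sum_mul]
  refine Finset.sum_le_sum fun s hs => ?_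
  have := pow_le_pow_right₀ hr (hm.2 hs)
  gcongr

/-- For `|θ| ≤ π/m` every `sθ` lies in `[-π, π]`, where `cos x ≤ 1 - (2/π²) x²`. This covers a fixed
neighbourhood of 0, so no shrinking window is needed. -/
theorem re_saddleExponent_le (hpos : ∀ s ∈ S, 0 < s) (hm : IsGreatest (S : Set ℕ) m) {r θ : ℝ}
    (hr : 0 ≤ r) (hθ : |θ| ≤ Real.pi / m) :
    (saddleExponent S r θ).re ≤ -(2 / Real.pi ^ 2) * (saddleVar S r * θ ^ 2) := by
  rw [re_saddleExponent, saddleVar, Finset.sum_mul, Finset.mul_sum]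
  refine Finset.sum_le_sum fun s hs => ?_
  have hs0 : (0 : ℝ) < s := by exact_mod_cast hpos s hs
  have hm0 : (0 : ℝ) < m := by exact_mod_cast hpos m hm.1
  have hsm : (s : ℝ) ≤ m := by exact_mod_cast hm.2 hs
  have habs : |(s : ℝ) * θ| ≤ Real.pi := by
    rw [abs_mul, abs_of_pos hs0]
    calc (s : ℝ) * |θ| ≤ m * (Real.pi / m) := by gcongr
      _ = Real.pi := by field_simp
  have h := Real.cos_le_one_sub_mul_cos_sq habs
  calc r ^ s / s * (Real.cos (s * θ) - 1) ≤ r ^ s / s * (-(2 / Real.pi ^ 2 * (s * θ) ^ 2)) := by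
        gcongr
        linarith
    _ = -(2 / Real.pi ^ 2) * (s * r ^ s * θ ^ 2) := by field_simp

/-- If every `cos (sθ)` were 1, the order of `θ` in the circle group would divide all `s`, hence
their gcd 1, making `θ` a multiple of `2π`. -/
theorem exists_cos_lt_one (hgcd : S.gcd id = 1) {θ : ℝ} (h0 : 0 < θ) (hπ : θ ≤ Real.pi) :
    ∃ s ∈ S, Real.cos (s * θ) < 1 := by
  by_contra! hcon
  have h1 : ∀ s ∈ S, addOrderOf (θ : Real.Angle) ∣ id s := by
    intro s hs
    rw [addOrderOf_dvd_iff_nsmul_eq_zero, id, ← Real.Angle.coe_nsmul, Real.Angle.coe_eq_zero_iff]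
    obtain ⟨n, hn⟩ := (Real.cos_eq_one_iff _).1 (le_antisymm (Real.cos_le_one _) (hcon s hs))
    exact ⟨n, by simpa using hn⟩
  have h2 := Finset.dvd_gcd h1
  rw [hgcd, Nat.dvd_one, AddMonoid.addOrderOf_eq_one_iff, Real.Angle.coe_eq_zero_iff] at h2
  obtain ⟨n, hn⟩ := h2
  rw [zsmul_eq_mul] at hn
  have hp := Real.pi_pos
  have hn0 : (0 : ℝ) < n := by
    by_contra! h
    nlinarith
  have hn1 : (1 : ℝ) ≤ n := by
    have : (0 : ℤ) < n := by exact_mod_cast hn0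
    exact_mod_cast this
  nlinarith

/-- Compactness gives a positive minimum of `∑ (1 - cos sθ)/s` on `[δ, π]`, and `r^s ≥ r` for `r ≥
1`. -/
theorem exists_re_saddleExponent_le (hpos : ∀ s ∈ S, 0 < s) (hgcd : S.gcd id = 1) {δ : ℝ}
    (hδ : 0 < δ) :
    ∃ c > 0, ∀ r : ℝ, 1 ≤ r → ∀ θ : ℝ, δ ≤ |θ| → |θ| ≤ Real.pi →
      (saddleExponent S r θ).re ≤ -c * r := by
  rcases le_or_gt δ Real.pi with hle | hlt
  · have hcont : ContinuousOn (fun θ : ℝ => ∑ s ∈ S, (1 - Real.cos (s * θ)) / s)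
        (Set.Icc δ Real.pi) := by fun_prop
    obtain ⟨θ₀, hθ₀, hmin⟩ := isCompact_Icc.exists_isMinOn (Set.nonempty_Icc.2 hle) hcont
    have hnn : ∀ (θ : ℝ), ∀ s ∈ S, 0 ≤ (1 - Real.cos (s * θ)) / s := fun θ s _ =>
      div_nonneg (sub_nonneg.2 (Real.cos_le_one _)) (Nat.cast_nonneg s)
    refine ⟨∑ s ∈ S, (1 - Real.cos (s * θ₀)) / s, ?_, ?_⟩
    · obtain ⟨s, hs, hcos⟩ := exists_cos_lt_one hgcd (hδ.trans_le hθ₀.1) hθ₀.2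
      refine Finset.sum_pos' (hnn θ₀) ⟨s, hs, div_pos (sub_pos.2 hcos) ?_⟩
      exact_mod_cast hpos s hs
    · intro r hr θ h1 h2
      have h3 : ∑ s ∈ S, (1 - Real.cos (s * θ₀)) / s ≤ ∑ s ∈ S, (1 - Real.cos (s * |θ|)) / s :=
        hmin ⟨h1, h2⟩
      have h4 : (saddleExponent S r θ).re ≤ -(∑ s ∈ S, (1 - Real.cos (s * |θ|)) / s) * r := by
        rw [re_saddleExponent, ← Finset.sum_neg_distrib, Finset.sum_mul]
        refine Finset.sum_le_sum fun s hs => ?_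
        have hcos : Real.cos (s * |θ|) = Real.cos (s * θ) := by
          rw [← Real.cos_abs (s * θ), abs_mul, Nat.abs_cast]
        have h5 := le_self_pow₀ hr (hpos s hs).ne'
        have h6 := hnn |θ| s hs
        rw [hcos] at h6 ⊢
        have h7 := mul_le_mul_of_nonneg_left h5 h6
        have h8 : r ^ s / s * (Real.cos (s * θ) - 1) = -((1 - Real.cos (s * θ)) / s * r ^ s) := by
          ring
        rw [h8]
        linarith
      nlinarith
  · exact ⟨1, one_pos, fun r _ θ h1 h2 => absurd (h1.trans h2) (not_le.2 hlt)⟩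

theorem norm_saddleExponent_add_le (hpos : ∀ s ∈ S, 0 < s) (hm : IsGreatest (S : Set ℕ) m)
    {r θ : ℝ} (hr : 0 ≤ r) (hθ : m * |θ| ≤ 1) :
    ‖saddleExponent S r θ + (saddleVar S r * θ ^ 2 / 2 : ℝ)‖ ≤ m * (saddleVar S r * |θ| ^ 3) := by
  rw [saddleExponent, saddleVar, Finset.sum_mul, Finset.sum_div, Complex.ofReal_sum,
    ← Finset.sum_add_distrib, Finset.sum_mul, Finset.mul_sum]
  refine (norm_sum_le _ _).trans (Finset.sum_le_sum fun s hs => ?_)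
  have hs0 : (0 : ℝ) < s := by exact_mod_cast hpos s hs
  have hs0' : (s : ℂ) ≠ 0 := by exact_mod_cast (hpos s hs).ne'
  have hsm : (s : ℝ) ≤ m := by exact_mod_cast hm.2 hs
  set x : ℂ := s * θ * I with hx
  have hnx : ‖x‖ = s * |θ| := by simp [hx]
  have hx1 : ‖x‖ ≤ 1 := by
    rw [hnx]
    exact (mul_le_mul_of_nonneg_right hsm (abs_nonneg θ)).trans hθ
  -- The cubic remainder constant supplied here is `4/18`, which is then bounded by 1.
  have h1 := Complex.exp_bound hx1 (n := 3) (by norm_num)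
  have h2 : ∑ k ∈ Finset.range 3, x ^ k / (k ! : ℂ) = 1 + x + x ^ 2 / 2 := by
    simp [Finset.sum_range_succ, Nat.factorial]
  have h3 : (r : ℂ) ^ s / s * (Complex.exp x - 1 - x) + ((s * r ^ s * θ ^ 2 / 2 : ℝ) : ℂ) =
      ((r ^ s / s : ℝ) : ℂ) * (Complex.exp x - (1 + x + x ^ 2 / 2)) := by
    rw [hx]
    push_cast
    field_simp
    rw [Complex.I_sq]
    ring
  rw [h3, norm_mul, Complex.norm_real, Real.norm_of_nonneg (by positivity), ← h2]
  calc r ^ s / s * ‖Complex.exp x - ∑ k ∈ Finset.range 3, x ^ k / (k ! : ℂ)‖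
      ≤ r ^ s / s * ‖x‖ ^ 3 := by
        gcongr
        refine h1.trans (mul_le_of_le_one_right (by positivity) ?_)
        norm_num [Nat.factorial]
    _ = s * (s * r ^ s * |θ| ^ 3) := by rw [hnx]; field_simp
    _ ≤ m * (s * r ^ s * |θ| ^ 3) := by gcongr

theorem tendsto_saddleVar_atTop (hpos : ∀ s ∈ S, 0 < s) (hm : IsGreatest (S : Set ℕ) m) :
    Tendsto (saddleVar S) atTop atTop :=
  tendsto_atTop_mono' _ ((eventually_ge_atTop 1).mono fun _ hr => le_saddleVar hpos hm hr)
    tendsto_id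

/-- After scaling by `√V` the quadratic term is exactly `-u²/2` and the cubic error is at most `m
|u|³ / √V`. -/
theorem tendsto_saddleExponent (hpos : ∀ s ∈ S, 0 < s) (hm : IsGreatest (S : Set ℕ) m) (u : ℝ) :
    Tendsto (fun r => saddleExponent S r (u / √(saddleVar S r))) atTop
      (𝓝 ((-(1 / 2) * u ^ 2 : ℝ) : ℂ)) := by
  have hsq : Tendsto (fun r => √(saddleVar S r)) atTop atTop :=
    Real.tendsto_sqrt_atTop.comp (tendsto_saddleVar_atTop hpos hm)
  have hsmall : ∀ᶠ r in atTop, m * |u / √(saddleVar S r)| ≤ 1 := by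
    have h : Tendsto (fun r => m * |u / √(saddleVar S r)|) atTop (𝓝 (m * |0|)) :=
      ((hsq.const_div_atTop u).abs).const_mul _
    rw [abs_zero, mul_zero] at h
    exact h.eventually_le_const one_pos
  rw [tendsto_iff_norm_sub_tendsto_zero]
  have hlim : Tendsto (fun r => m * |u| ^ 3 / √(saddleVar S r)) atTop (𝓝 0) :=
    hsq.const_div_atTop _
  refine squeeze_zero' (Eventually.of_forall fun _ => norm_nonneg _) ?_ hlim
  filter_upwards [hsmall, eventually_ge_atTop 1] with r h1 hr
  have hv : 0 < saddleVar S r := by linarith [le_saddleVar hpos hm hr]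
  have hsqpos := Real.sqrt_pos.2 hv
  have hss := Real.sq_sqrt hv.le
  have h2 := norm_saddleExponent_add_le hpos hm (r := r) (by linarith) h1
  have h3 : saddleVar S r * (u / √(saddleVar S r)) ^ 2 / 2 = -(-(1 / 2) * u ^ 2) := by
    rw [div_pow, hss]
    field_simp
  rw [h3, Complex.ofReal_neg, ← sub_eq_add_neg] at h2
  refine h2.trans_eq ?_
  rw [abs_div, abs_of_pos hsqpos, div_pow]
  nth_rewrite 1 [← hss]
  field_simp

/-- Substitute `θ = u/√V` and use dominated convergence with the majorant `exp (-2u²/π²)`, which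
does not depend on `r`. -/
theorem tendsto_integral_center (hpos : ∀ s ∈ S, 0 < s) (hm : IsGreatest (S : Set ℕ) m) :
    Tendsto (fun r => (√(saddleVar S r) : ℂ) *
      ∫ θ in (-(Real.pi / m))..(Real.pi / m), Complex.exp (saddleExponent S r θ)) atTop
      (𝓝 (√(2 * Real.pi) : ℂ)) := by
  set δ := Real.pi / m with hδ
  have hδ0 : 0 < δ := div_pos Real.pi_pos (by exact_mod_cast hpos m hm.1)
  have hsq : Tendsto (fun r => √(saddleVar S r)) atTop atTop :=
    Real.tendsto_sqrt_atTop.comp (tendsto_saddleVar_atTop hpos hm)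
  have hlim : ∫ u : ℝ, Complex.exp ((-(1 / 2) * u ^ 2 : ℝ) : ℂ) = (√(2 * Real.pi) : ℂ) := by
    simp_rw [← Complex.ofReal_exp]
    rw [integral_complex_ofReal, integral_gaussian]
    congr 3
    ring
  rw [← hlim]
  have hmain : Tendsto (fun r => ∫ u : ℝ, (Set.Ioc (-δ * √(saddleVar S r)) (δ * √(saddleVar S r))).indicator
      (fun u => Complex.exp (saddleExponent S r (u / √(saddleVar S r)))) u) atTop
      (𝓝 (∫ u : ℝ, Complex.exp ((-(1 / 2) * u ^ 2 : ℝ) : ℂ))) := by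
    refine tendsto_integral_filter_of_dominated_convergence
      (fun u => Real.exp (-(2 / Real.pi ^ 2) * u ^ 2)) ?_ ?_
      (integrable_exp_neg_mul_sq (by positivity)) ?_
    · refine Eventually.of_forall fun r => ?_
      refine AEStronglyMeasurable.indicator ?_ measurableSet_Ioc
      have := continuous_saddleExponent S r
      exact Continuous.aestronglyMeasurable (by fun_prop)
    · filter_upwards [eventually_ge_atTop 1] with r hr
      refine Eventually.of_forall fun u => ?_
      have hv : 0 < saddleVar S r := by linarith [le_saddleVar hpos hm hr]
      have hsqpos := Real.sqrt_pos.2 hv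
      rw [Set.indicator_apply]
      split_ifs with hu
      swap
      · rw [norm_zero]
        exact (Real.exp_pos _).le
      have h1 := re_saddleExponent_le hpos hm (r := r) (θ := u / √(saddleVar S r)) (by linarith)
        (by
          rw [abs_div, abs_of_pos hsqpos, div_le_iff₀ hsqpos, abs_le]
          exact ⟨by linarith [hu.1], hu.2⟩)
      rw [div_pow, Real.sq_sqrt hv.le, mul_div_cancel₀ _ hv.ne'] at h1
      rw [Complex.norm_exp]
      exact Real.exp_le_exp.2 h1
    · refine Eventually.of_forall fun u => ?_
      refine ((Complex.continuous_exp.tendsto _).comp (tendsto_saddleExponent hpos hm u)).congr' ?_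
      filter_upwards [hsq.eventually_gt_atTop (|u| / δ)] with r hr
      rw [div_lt_iff₀ hδ0, abs_lt] at hr
      have hu : u ∈ Set.Ioc (-δ * √(saddleVar S r)) (δ * √(saddleVar S r)) :=
        ⟨by linarith [hr.1], by linarith [hr.2]⟩
      rw [Set.indicator_of_mem hu, Function.comp_apply]
  refine hmain.congr' ?_
  filter_upwards [eventually_ge_atTop 1] with r hr
  have hv : 0 < saddleVar S r := by linarith [le_saddleVar hpos hm hr]
  have hsqpos := Real.sqrt_pos.2 hv
  rw [integral_indicator measurableSet_Ioc, ← intervalIntegral.integral_of_le (by nlinarith),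
    intervalIntegral.integral_comp_div (fun θ => Complex.exp (saddleExponent S r θ)) hsqpos.ne',
    mul_div_cancel_right₀ _ hsqpos.ne', mul_div_cancel_right₀ _ hsqpos.ne', Complex.real_smul]

theorem tendsto_integral_tail (hpos : ∀ s ∈ S, 0 < s) (hgcd : S.gcd id = 1)
    (hm : IsGreatest (S : Set ℕ) m) {δ : ℝ} (hδ : 0 < δ) {a b : ℝ}
    (hab : ∀ θ ∈ Set.uIoc a b, δ ≤ |θ| ∧ |θ| ≤ Real.pi) :
    Tendsto (fun r => (√(saddleVar S r) : ℂ) *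
      ∫ θ in a..b, Complex.exp (saddleExponent S r θ)) atTop (𝓝 0) := by
  obtain ⟨c, hc, hbound⟩ := exists_re_saddleExponent_le hpos hgcd hδ
  have hlim := ((tendsto_rpow_mul_exp_neg_mul_atTop_nhds_zero m c hc).const_mul
    ((∑ s ∈ S, (s : ℝ)) * |b - a|))
  rw [mul_zero] at hlim
  refine squeeze_zero_norm' ?_ hlim
  filter_upwards [eventually_ge_atTop 1] with r hr
  have hv : 1 ≤ saddleVar S r := hr.trans (le_saddleVar hpos hm hr)
  have h1 : ‖∫ θ in a..b, Complex.exp (saddleExponent S r θ)‖ ≤ Real.exp (-c * r) * |b - a| := by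
    refine intervalIntegral.norm_integral_le_of_norm_le_const fun θ hθ => ?_
    rw [Complex.norm_exp]
    exact Real.exp_le_exp.2 (hbound r hr θ (hab θ hθ).1 (hab θ hθ).2)
  -- A crude polynomial bound suffices against the factor `exp (-c r)`.
  have h2 : √(saddleVar S r) ≤ (∑ s ∈ S, (s : ℝ)) * r ^ m :=
    (Real.sqrt_le_self_iff.2 (Or.inr hv)).trans (saddleVar_le hm hr)
  rw [norm_mul, Complex.norm_real, Real.norm_of_nonneg (Real.sqrt_nonneg _), Real.rpow_natCast]
  calc _ ≤ ((∑ s ∈ S, (s : ℝ)) * r ^ m) * (Real.exp (-c * r) * |b - a|) := by gcongr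
    _ = _ := by ring

theorem tendsto_integral_saddleExponent (hpos : ∀ s ∈ S, 0 < s) (hgcd : S.gcd id = 1)
    (hm : IsGreatest (S : Set ℕ) m) :
    Tendsto (fun r => (√(saddleVar S r) : ℂ) *
      ∫ θ in (-Real.pi)..Real.pi, Complex.exp (saddleExponent S r θ)) atTop
      (𝓝 (√(2 * Real.pi) : ℂ)) := by
  have hm1 : (1 : ℝ) ≤ m := by exact_mod_cast hpos m hm.1
  have hπ := Real.pi_pos
  have hδ0 : 0 < Real.pi / m := by positivity
  have hδπ : Real.pi / m ≤ Real.pi := div_le_self hπ.le hm1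
  have hc := tendsto_integral_center hpos hm
  have h1 := tendsto_integral_tail hpos hgcd hm hδ0 (a := -Real.pi) (b := -(Real.pi / m)) (by
    intro θ hθ
    rw [Set.uIoc_of_le (by linarith)] at hθ
    rw [abs_of_nonpos (by linarith [hθ.2])]
    constructor <;> linarith [hθ.1, hθ.2])
  have h2 := tendsto_integral_tail hpos hgcd hm hδ0 (a := Real.pi / m) (b := Real.pi) (by
    intro θ hθ
    rw [Set.uIoc_of_le (by linarith)] at hθ
    rw [abs_of_nonneg (by linarith [hθ.1])]
    constructor <;> linarith [hθ.1, hθ.2])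
  have h := (h1.add hc).add h2
  rw [zero_add, add_zero] at h
  refine h.congr fun r => ?_
  have hi : ∀ a b : ℝ, IntervalIntegrable (fun θ => Complex.exp (saddleExponent S r θ)) volume a b :=
    fun a b => (Complex.continuous_exp.comp (continuous_saddleExponent S r)).intervalIntegrable a b
  rw [← mul_add, ← mul_add, intervalIntegral.integral_add_adjacent_intervals (hi _ _) (hi _ _),
    intervalIntegral.integral_add_adjacent_intervals (hi _ _) (hi _ _)]

end SaddlePoint

/-! ### The degree of the leading polynomial -/

section Degree

/-- Powers `B^j` with `j ≥ 2` start at order `2d > k`, so only the linear term of the binomial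
series is seen. -/
theorem powCoeff_eq_mul_coeff {B : ℝ[X]} {d : ℕ} (hB : Polynomial.X ^ d ∣ B) (α : ℝ) {k : ℕ}
    (hk : 1 ≤ k) (hkd : k ≤ d) : powCoeff B α k = α * B.coeff k := by
  rw [powCoeff, Finset.sum_eq_single 1]
  · simp [genBinom]
  · intro j _ hj
    rcases Nat.eq_zero_or_pos j with rfl | hj0
    · rw [pow_zero, Polynomial.coeff_one, if_neg (by omega), mul_zero]
    · have h1 : Polynomial.X ^ (d * j) ∣ B ^ j := by
        rw [pow_mul]
        exact pow_dvd_pow_of_dvd hB j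
      have h2 : k < d * j := by
        have : 2 ≤ j := by omega
        nlinarith
      rw [Polynomial.X_pow_dvd_iff.1 h1 k h2, mul_zero]
  · intro h
    exact absurd (Finset.mem_range.2 (by omega)) h

variable {S : Finset ℕ} {m : ℕ}

theorem coeff_leadingPoly (S : Finset ℕ) (m j : ℕ) :
    (leadingPoly S m).coeff j = if 1 ≤ j ∧ j < m then
      (m : ℝ) / (((m - j : ℕ) : ℝ) * ((m : ℝ) - (m - j : ℕ))) *
      powCoeff (revTail S m) (((m - j : ℕ) : ℝ) / m) (m - j) else 0 := by
  rw [leadingPoly, Polynomial.finsetSum_coeff]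
  simp_rw [Polynomial.coeff_C_mul, Polynomial.coeff_X_pow]
  split_ifs with h
  · rw [Finset.sum_eq_single (m - j)]
    · rw [if_pos (by omega), mul_one]
    · intro k hk hne
      rw [Finset.mem_Ico] at hk
      rw [if_neg (by omega), mul_zero]
    · intro hn
      exact absurd (Finset.mem_Ico.2 ⟨by omega, by omega⟩) hn
  · refine Finset.sum_eq_zero fun k hk => ?_
    rw [Finset.mem_Ico] at hk
    rw [if_neg (by omega), mul_zero]

theorem natDegree_leadingPoly_le (S : Finset ℕ) (m : ℕ) : (leadingPoly S m).natDegree ≤ m - 1 := by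
  rw [Polynomial.natDegree_le_iff_coeff_eq_zero]
  intro j hj
  rw [coeff_leadingPoly, if_neg (by omega)]

theorem X_pow_dvd_revTail (S : Finset ℕ) (m : ℕ) :
    Polynomial.X ^ (m - (S.erase m).sup id) ∣ revTail S m := by
  refine Finset.dvd_sum fun s hs => pow_dvd_pow _ ?_
  have h1 : s ≤ (S.erase m).sup id := Finset.le_sup (f := id) hs
  omega

theorem natDegree_leadingPoly (hpos : ∀ s ∈ S, 0 < s) (hm : IsGreatest (S : Set ℕ) m) :
    (leadingPoly S m).natDegree = (S.erase m).sup id := by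
  have hdvd := X_pow_dvd_revTail S m
  rcases (S.erase m).eq_empty_or_nonempty with hE | hne
  · have hB : revTail S m = 0 := by rw [revTail, hE, Finset.sum_empty]
    have h0 : leadingPoly S m = 0 := by
      ext j
      rw [coeff_leadingPoly]
      split_ifs with h
      -- Here `S = {m}` and `B = 0`, so any exponent divides; `m` is large enough for all indices in
      -- use. The supremum of the empty set is 0, matching the degree of 0.
      · rw [hB, powCoeff_eq_mul_coeff (dvd_zero (Polynomial.X ^ m)) _ (by omega) (by omega)]
        simp
      · simp
    rw [h0, hE]
    simp
  · obtain ⟨s₀, hs₀, hsup⟩ := Finset.exists_mem_eq_sup _ hne id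
    rw [hsup, id] at hdvd ⊢
    have hlt := lt_of_mem_erase_of_isGreatest hm hs₀
    have hs0 := hpos s₀ (Finset.mem_of_mem_erase hs₀)
    have hcoeff : (revTail S m).coeff (m - s₀) = 1 := by
      rw [revTail, Polynomial.finsetSum_coeff, Finset.sum_eq_single s₀]
      · simp
      · intro s hs hne
        have := lt_of_mem_erase_of_isGreatest hm hs
        rw [Polynomial.coeff_X_pow, if_neg (by omega)]
      · exact fun h => absurd hs₀ h
    refine Polynomial.natDegree_eq_of_le_of_coeff_ne_zero ?_ ?_
    · rw [Polynomial.natDegree_le_iff_coeff_eq_zero]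
      intro j hj
      rw [coeff_leadingPoly]
      split_ifs with h
      · rw [powCoeff_eq_mul_coeff hdvd _ (by omega) (by omega),
          Polynomial.X_pow_dvd_iff.1 hdvd _ (by omega)]
        simp
      · rfl
    · rw [coeff_leadingPoly, if_pos ⟨hs0, hlt⟩,
        powCoeff_eq_mul_coeff hdvd _ (by omega) le_rfl, hcoeff, Nat.cast_sub hlt.le]
      have h1 : (s₀ : ℝ) < m := by exact_mod_cast hlt
      have h2 : (0 : ℝ) < s₀ := by exact_mod_cast hs0
      have h3 : (0 : ℝ) < m := h2.trans h1
      have h4 : (0 : ℝ) < m - s₀ := sub_pos.2 h1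
      rw [sub_sub_cancel]
      positivity

theorem leadingConst_pos (hm : 0 < m) : 0 < leadingConst S m := by
  have : (0 : ℝ) < m := by exact_mod_cast hm
  have := Real.pi_pos
  unfold leadingConst
  positivity

end Degree

/-! ### Expansion at the saddle point and the final asymptotics -/

section Asymptotics

variable {S : Finset ℕ} {m : ℕ}

theorem exists_saddlePoint (hpos : ∀ s ∈ S, 0 < s) (hm : IsGreatest (S : Set ℕ) m) (n : ℕ) :
    ∃ r : ℝ, 0 ≤ r ∧ ∑ s ∈ S, r ^ s = n := by
  have hcont : ContinuousOn (fun r : ℝ => ∑ s ∈ S, r ^ s) (Set.Icc 0 n) := by fun_prop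
  have h0 : ∑ s ∈ S, (0 : ℝ) ^ s = 0 :=
    Finset.sum_eq_zero fun s hs => zero_pow (hpos s hs).ne'
  have h1 : (n : ℝ) ≤ ∑ s ∈ S, (n : ℝ) ^ s := by
    rcases Nat.eq_zero_or_pos n with rfl | hn
    · simp only [Nat.cast_zero, h0, le_refl]
    · calc (n : ℝ) ≤ (n : ℝ) ^ m := le_self_pow₀ (by exact_mod_cast hn) (hpos m hm.1).ne'
        _ ≤ _ := Finset.single_le_sum (f := fun s => (n : ℝ) ^ s) (fun s _ => by positivity) hm.1
  obtain ⟨r, hr, hrn⟩ := intermediate_value_Icc (Nat.cast_nonneg n) hcont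
    ⟨by simp only [h0, Nat.cast_nonneg], h1⟩
  exact ⟨r, hr.1, hrn⟩

/-- If `r n < R`, monotonicity bounds `n` by `∑ R^s`. -/
theorem tendsto_saddlePoint {r : ℕ → ℝ} (hr : ∀ n, 0 ≤ r n)
    (hrn : ∀ n, ∑ s ∈ S, r n ^ s = n) : Tendsto r atTop atTop := by
  rw [tendsto_atTop]
  intro R
  filter_upwards [tendsto_natCast_atTop_atTop.eventually_gt_atTop (∑ s ∈ S, R ^ s)] with n hn
  by_contra! h
  rw [← hrn n] at hn
  have h0 := hr n
  refine absurd hn (not_lt.2 (Finset.sum_le_sum fun s _ => ?_))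
  gcongr

theorem tendsto_sum_mul_pow_div_pow (hm : IsGreatest (S : Set ℕ) m) (c : ℕ → ℝ) :
    Tendsto (fun r : ℝ => (∑ s ∈ S, c s * r ^ s) / r ^ m) atTop (𝓝 (c m)) := by
  have h : ∀ s ∈ S, Tendsto (fun r : ℝ => c s * r ^ s / r ^ m) atTop
      (𝓝 (if s = m then c m else 0)) := by
    intro s hs
    split_ifs with h
    · subst h
      refine tendsto_const_nhds.congr' ?_
      filter_upwards [eventually_gt_atTop 0] with r hr
      field_simp
    · have := (tendsto_pow_div_pow_atTop_zero (𝕜 := ℝ) (lt_of_le_of_ne (hm.2 hs) h)).const_mul (c s)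
      rw [mul_zero] at this
      exact this.congr fun r => by ring
  have h2 := tendsto_finsetSum S h
  rw [Finset.sum_ite_eq' S m, if_pos (by exact hm.1)] at h2
  exact h2.congr fun r => by rw [Finset.sum_div]

theorem tendsto_saddleVar_div (hm : IsGreatest (S : Set ℕ) m) :
    Tendsto (fun r : ℝ => saddleVar S r / ∑ s ∈ S, r ^ s) atTop (𝓝 m) := by
  have h1 := tendsto_sum_mul_pow_div_pow hm fun s => (s : ℝ)
  have h2 := tendsto_sum_mul_pow_div_pow hm fun _ => 1
  have h3 := h1.div h2 one_ne_zero
  rw [div_one] at h3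
  refine h3.congr' ?_
  filter_upwards [eventually_gt_atTop 0] with r hr
  simp only [one_mul, Pi.div_apply]
  rw [div_div_div_cancel_right₀ (by positivity), saddleVar]

theorem pow_mul_inv_pow_sub {r : ℝ} (hr : r ≠ 0) {s m : ℕ} (h : s ≤ m) :
    r ^ m * r⁻¹ ^ (m - s) = r ^ s := by
  rw [← Nat.sub_add_cancel h, Nat.add_sub_cancel, pow_add, inv_pow]
  field_simp

theorem sum_pow_eq (hm : IsGreatest (S : Set ℕ) m) {r : ℝ} (hr : 0 < r) :
    ∑ s ∈ S, r ^ s = r ^ m * (1 + (revTail S m).eval r⁻¹) := by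
  have h := congrArg (Polynomial.eval r⁻¹) (one_add_revTail hm)
  rw [Polynomial.eval_add, Polynomial.eval_one] at h
  rw [h, Polynomial.eval_finsetSum, Finset.mul_sum]
  refine Finset.sum_congr rfl fun s hs => ?_
  rw [Polynomial.eval_pow, Polynomial.eval_X, pow_mul_inv_pow_sub hr.ne' (hm.2 hs)]

theorem sum_pow_div_eq (hm : IsGreatest (S : Set ℕ) m) {r : ℝ} (hr : 0 < r) :
    ∑ s ∈ S, r ^ s / s = r ^ m * (revPotential S m).eval r⁻¹ := by
  rw [revPotential, Polynomial.eval_finsetSum, Finset.mul_sum]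
  refine Finset.sum_congr rfl fun s hs => ?_
  rw [Polynomial.eval_mul, Polynomial.eval_C, Polynomial.eval_pow, Polynomial.eval_X,
    mul_left_comm, pow_mul_inv_pow_sub hr.ne' (hm.2 hs)]
  ring

/-- This is `N y^k = x^(m-k)` for `y = N^(-1/m)` and `x = N^(1/m)`, since `y = r⁻¹ A^(-1/m)`. -/
theorem mul_inv_pow_mul_rpow {m k : ℕ} (hm : 0 < m) (hk : k ≤ m) {r A N : ℝ} (hr : 0 < r)
    (hA : 0 < A) (hN : N = r ^ m * A) :
    N * (r⁻¹ ^ k * A ^ (-((k : ℝ) / m))) = (N ^ ((1 : ℝ) / m)) ^ (m - k) := by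
  have hm0 : (m : ℝ) ≠ 0 := by exact_mod_cast hm.ne'
  have hN0 : 0 < N := by rw [hN]; positivity
  have h1 : r⁻¹ ^ k * A ^ (-((k : ℝ) / m)) = N ^ (-((k : ℝ) / m)) := by
    rw [hN, Real.mul_rpow (by positivity) hA.le, ← Real.rpow_natCast r m, ← Real.rpow_mul hr.le,
      show (m : ℝ) * (-(k / m)) = -k by field_simp, Real.rpow_neg hr.le, Real.rpow_natCast, inv_pow]
  rw [h1, ← Real.rpow_natCast, ← Real.rpow_mul hN0.le, Nat.cast_sub hk]
  nth_rewrite 1 [← Real.rpow_one N]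
  rw [← Real.rpow_add hN0]
  congr 1
  field_simp
  ring

theorem eval_leadingPoly_add (hpos : ∀ s ∈ S, 0 < s) (hm : IsGreatest (S : Set ℕ) m) {r A N : ℝ}
    (hr : 0 < r) (hA : 0 < A) (hN : N = r ^ m * A) :
    N * ∑ k ∈ Finset.Icc 1 m, lagrangeCoeff (revTail S m) m k (saddleSeries S m) / k *
      (r⁻¹ ^ k * A ^ (-((k : ℝ) / m))) =
      (leadingPoly S m).eval (N ^ ((1 : ℝ) / m)) +
        -(1 / (m : ℝ)) * ∑ s ∈ S, logCoeff (revTail S m) s := by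
  have hm1 := hpos m hm.1
  have hm0 : (m : ℝ) ≠ 0 := by exact_mod_cast hm1.ne'
  rw [← Finset.Ico_insert_right (show 1 ≤ m from hm1), Finset.sum_insert (by simp), mul_add,
    add_comm]
  congr 1
  · rw [leadingPoly, Polynomial.eval_finsetSum, Finset.mul_sum]
    refine Finset.sum_congr rfl fun k hk => ?_
    rw [Finset.mem_Ico] at hk
    rw [mul_left_comm, mul_inv_pow_mul_rpow hm1 hk.2.le hr hA hN,
      lagrangeCoeff_saddleSeries_of_lt hpos hm hk.1 hk.2, Polynomial.eval_mul, Polynomial.eval_C,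
      Polynomial.eval_pow, Polynomial.eval_X]
    congr 1
    have h1 : (k : ℝ) ≠ 0 := by exact_mod_cast (show k ≠ 0 by omega)
    have h2 : (m : ℝ) - k ≠ 0 := by
      have : (k : ℝ) < m := by exact_mod_cast hk.2
      exact sub_ne_zero.2 this.ne'
    field_simp
  · rw [mul_left_comm, mul_inv_pow_mul_rpow hm1 le_rfl hr hA hN,
      lagrangeCoeff_saddleSeries_self hpos hm, Nat.sub_self, pow_zero]
    ring

/-- The saddle point value expands into the leading polynomial. -/
theorem tendsto_saddle_exponent (hpos : ∀ s ∈ S, 0 < s) (hm : IsGreatest (S : Set ℕ) m)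
    {r : ℕ → ℝ} (hr : ∀ n, 0 ≤ r n) (hrn : ∀ n, ∑ s ∈ S, r n ^ s = n) :
    Tendsto (fun n : ℕ => ∑ s ∈ S, r n ^ s / s - n * Real.log (r n) +
      (n * Real.log n - n) / m - (leadingPoly S m).eval ((n : ℝ) ^ ((1 : ℝ) / m))) atTop
      (𝓝 (-(1 / (m : ℝ)) * ∑ s ∈ S, logCoeff (revTail S m) s)) := by
  have hB := coeff_zero_revTail hm
  have hm0 : (m : ℝ) ≠ 0 := by exact_mod_cast (hpos m hm.1).ne'
  have hrtop := tendsto_saddlePoint hr hrn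
  have hw : Tendsto (fun n => (r n)⁻¹) atTop (𝓝 0) := tendsto_inv_atTop_zero.comp hrtop
  have hO := (isBigO_refl (fun n : ℕ => (n : ℝ)) atTop).mul
    ((saddle_isBigO hpos hm).comp_tendsto hw)
  -- Since `n = r^m A(w)`, the error scale `n w^(m+1)` equals `A(w) w`.
  have hsmall : Tendsto (fun n : ℕ => (n : ℝ) * (r n)⁻¹ ^ (m + 1)) atTop (𝓝 0) := by
    have h1 : Tendsto (fun n => (1 + (revTail S m).eval (r n)⁻¹) * (r n)⁻¹) atTop
        (𝓝 ((1 + (revTail S m).eval 0) * 0)) :=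
      ((((revTail S m).continuous.tendsto 0).comp hw).const_add 1).mul hw
    rw [mul_zero] at h1
    refine h1.congr' ?_
    filter_upwards [hrtop.eventually_gt_atTop 0] with n hn
    rw [← hrn n, sum_pow_eq hm hn, pow_succ, inv_pow]
    field_simp
  have hlim := (hO.trans_tendsto hsmall).add_const
    (-(1 / (m : ℝ)) * ∑ s ∈ S, logCoeff (revTail S m) s)
  rw [zero_add] at hlim
  refine hlim.congr' ?_
  filter_upwards [hrtop.eventually_gt_atTop 0, hw.eventually (eventually_one_add_eval_pos hB)]
    with n hn hA
  set A := 1 + (revTail S m).eval (r n)⁻¹ with hAdef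
  have hN : (n : ℝ) = r n ^ m * A := by rw [← hrn n, sum_pow_eq hm hn]
  have hlog : Real.log n = m * Real.log (r n) + Real.log A := by
    rw [hN, Real.log_mul (by positivity) hA.ne', Real.log_pow]
  have hexp := eval_leadingPoly_add hpos hm hn hA hN
  have hP : ∑ s ∈ S, r n ^ s / s = n * ((revPotential S m).eval (r n)⁻¹ * A ^ (-1 : ℝ)) := by
    rw [sum_pow_div_eq hm hn, hN, Real.rpow_neg_one]
    field_simp
  simp only [Function.comp_apply, ← hAdef]
  rw [mul_sub, hexp, hP, hlog]
  field_simp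
  ring

theorem tendsto_sPermProb_mul (hpos : ∀ s ∈ S, 0 < s) (hgcd : S.gcd id = 1)
    (hm : IsGreatest (S : Set ℕ) m) {r : ℕ → ℝ} (hr : ∀ n, 0 ≤ r n)
    (hrn : ∀ n, ∑ s ∈ S, r n ^ s = n) :
    Tendsto (fun n : ℕ => sPermProb S n * r n ^ n * √(saddleVar S (r n)) *
      Real.exp (-∑ s ∈ S, r n ^ s / s)) atTop (𝓝 (1 / √(2 * Real.pi))) := by
  have h1 := (tendsto_integral_saddleExponent hpos hgcd hm).comp (tendsto_saddlePoint hr hrn)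
  have h2 := ((Complex.continuous_re.tendsto _).comp h1).div_const (2 * Real.pi)
  have hπ := Real.pi_pos
  have h3 : (√(2 * Real.pi) : ℂ).re / (2 * Real.pi) = 1 / √(2 * Real.pi) := by
    rw [Complex.ofReal_re, Real.sqrt_div_self']
  rw [h3] at h2
  refine h2.congr fun n => ?_
  have h4 := exp_mul_integral_saddleExponent hpos (hrn n)
  set J := ∫ θ in (-Real.pi)..Real.pi, Complex.exp (saddleExponent S (r n) θ) with hJ
  have h5 : J = ((Real.exp (-∑ s ∈ S, r n ^ s / s) *
      (2 * Real.pi * (sPermProb S n * r n ^ n)) : ℝ) : ℂ) := by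
    push_cast
    rw [← h4, ← mul_assoc, ← Complex.exp_add, neg_add_cancel, Complex.exp_zero, one_mul]
  simp only [Function.comp_apply, ← hJ]
  rw [h5, ← Complex.ofReal_mul, Complex.ofReal_re]
  field_simp

theorem tendsto_sPermProb_normalized (hpos : ∀ s ∈ S, 0 < s) (hgcd : S.gcd id = 1)
    (hm : IsGreatest (S : Set ℕ) m) :
    Tendsto (fun n : ℕ => sPermProb S n * (n ! : ℝ) ^ ((1 : ℝ) / (m : ℝ)) /
      ((n : ℝ) ^ (-(1 / 2 : ℝ) + 1 / (2 * (m : ℝ))) *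
        Real.exp ((leadingPoly S m).eval ((n : ℝ) ^ ((1 : ℝ) / (m : ℝ)))))) atTop
      (𝓝 (leadingConst S m)) := by
  choose r hr hrn using exists_saddlePoint hpos hm
  have hπ := Real.pi_pos
  have hm1 : (0 : ℝ) < m := by exact_mod_cast hpos m hm.1
  have hrtop := tendsto_saddlePoint hr hrn
  have hmain := tendsto_sPermProb_mul hpos hgcd hm hr hrn
  have hexp := (Real.continuous_exp.tendsto _).comp (tendsto_saddle_exponent hpos hm hr hrn)
  have hvar : Tendsto (fun n => √(saddleVar S (r n) / n)) atTop (𝓝 √m) := by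
    have h := (tendsto_saddleVar_div hm).comp hrtop
    simp only [Function.comp_def, hrn] at h
    exact h.sqrt
  have hst : Tendsto (fun n : ℕ => ((n ! : ℝ) / (√(2 * n * Real.pi) * (n / Real.exp 1) ^ n)) ^
      ((1 : ℝ) / m)) atTop (𝓝 1) := by
    have h0 : ∀ᶠ n : ℕ in atTop, √(2 * n * Real.pi) * (n / Real.exp 1) ^ n ≠ 0 := by
      filter_upwards [eventually_gt_atTop 0] with n hn
      have : (0 : ℝ) < n := by exact_mod_cast hn
      positivity
    have h := (isEquivalent_iff_tendsto_one h0).1 Stirling.factorial_isEquivalent_stirling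
    simpa using h.rpow_const (p := (1 : ℝ) / m) (Or.inl one_ne_zero)
  have hall := (((hmain.mul hst).mul_const ((2 * Real.pi) ^ ((1 : ℝ) / (2 * m)))).mul hexp).div hvar
    (Real.sqrt_pos.2 hm1).ne'
  -- The factors come, in order, from the Gaussian integral, the Stirling ratio, the `2π` in
  -- Stirling's formula, the `y^m` term, and `V ~ m n`.
  have hC : 1 / √(2 * Real.pi) * 1 * (2 * Real.pi) ^ ((1 : ℝ) / (2 * m)) *
      Real.exp (-(1 / (m : ℝ)) * ∑ s ∈ S, logCoeff (revTail S m) s) / √m = leadingConst S m := by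
    rw [leadingConst, Real.sqrt_mul (x := 2 * Real.pi) (by positivity)]
    field_simp
  rw [hC] at hall
  refine hall.congr' ?_
  filter_upwards [eventually_gt_atTop 0, hrtop.eventually_ge_atTop 1] with n hn hr1
  have hn0 : (0 : ℝ) < n := by exact_mod_cast hn
  have hrpos : 0 < r n := by linarith
  have hv : 0 < saddleVar S (r n) := by linarith [le_saddleVar hpos hm hr1]
  have hfac : (n ! : ℝ) ^ ((1 : ℝ) / m) =
      ((n ! : ℝ) / (√(2 * n * Real.pi) * (n / Real.exp 1) ^ n)) ^ ((1 : ℝ) / m) *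
      ((2 * Real.pi) ^ ((1 : ℝ) / (2 * m)) * (n : ℝ) ^ ((1 : ℝ) / (2 * m)) *
        Real.exp ((n * Real.log n - n) / m)) := by
    have h1 : (n / Real.exp 1) ^ n = Real.exp (n * Real.log n - n) := by
      rw [← Real.exp_log hn0, ← Real.exp_sub, ← Real.exp_nat_mul, Real.exp_log hn0]
      congr 1
      ring
    have h2 : (√(2 * n * Real.pi) * (n / Real.exp 1) ^ n) ^ ((1 : ℝ) / m) =
        (2 * Real.pi) ^ ((1 : ℝ) / (2 * m)) * (n : ℝ) ^ ((1 : ℝ) / (2 * m)) *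
        Real.exp ((n * Real.log n - n) / m) := by
      rw [h1, Real.mul_rpow (by positivity) (by positivity), ← Real.exp_mul, Real.sqrt_eq_rpow,
        ← Real.rpow_mul (by positivity), ← Real.mul_rpow (by positivity) (by positivity)]
      congr 2
      · ring
      · field_simp
      · ring
    rw [← h2, ← Real.mul_rpow (by positivity) (by positivity), div_mul_cancel₀ _ (by positivity)]
  have hrpow : r n ^ n = Real.exp (n * Real.log (r n)) := by
    rw [Real.exp_nat_mul, Real.exp_log hrpos]
  rw [Pi.div_apply, Function.comp_apply, hfac, hrpow, Real.rpow_add hn0, Real.rpow_neg hn0.le,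
    ← Real.sqrt_eq_rpow, Real.sqrt_div hv.le, Real.exp_sub, Real.exp_add, Real.exp_sub,
    Real.exp_neg]
  have hsv := Real.sqrt_pos.2 hv
  field_simp

theorem tendsto_log_div_log_factorial {u : ℕ → ℝ} (hu : u =o[atTop] fun n : ℕ => (n : ℝ)) :
    Tendsto (fun n => u n / Real.log (n ! : ℝ)) atTop (𝓝 0) := by
  -- By Stirling, `log n!` is at least `n log n - n`, hence at least `n` once `log n ≥ 2`.
  have hO : (fun n : ℕ => (n : ℝ)) =O[atTop] fun n : ℕ => Real.log (n ! : ℝ) := by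
    refine IsBigO.of_bound 1 ?_
    filter_upwards [eventually_gt_atTop 0, (Real.tendsto_log_atTop.comp
      tendsto_natCast_atTop_atTop).eventually_ge_atTop 2] with n hn hlog
    rw [Function.comp_apply] at hlog
    have hn0 : (0 : ℝ) < n := by exact_mod_cast hn
    have h1 := Stirling.le_log_factorial_stirling hn.ne'
    have h2 : 0 < Real.log (2 * Real.pi) := Real.log_pos (by linarith [Real.pi_gt_three])
    rw [one_mul, Real.norm_of_nonneg hn0.le]
    refine le_trans ?_ (le_abs_self _)
    nlinarith
  exact (hu.trans_isBigO hO).tendsto_div_nhds_zero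

/-- In `log p_n + (1/m) log n!` the constant, the `log n` term and `f_S(n^(1/m))` are all `o(n)`,
the last because `deg f_S < m`. -/
theorem tendsto_log_sPermProb_div (hpos : ∀ s ∈ S, 0 < s) (hgcd : S.gcd id = 1)
    (hm : IsGreatest (S : Set ℕ) m) :
    Tendsto (fun n : ℕ => Real.log (sPermProb S n) / Real.log (n ! : ℝ)) atTop
      (𝓝 (-(1 / (m : ℝ)))) := by
  have hm1 := hpos m hm.1
  have hC : 0 < leadingConst S m := leadingConst_pos hm1
  have hnorm := tendsto_sPermProb_normalized hpos hgcd hm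
  have hlog := hnorm.log hC.ne'
  have hnat : Tendsto (fun n : ℕ => (n : ℝ)) atTop atTop := tendsto_natCast_atTop_atTop
  have hx : Tendsto (fun n : ℕ => (n : ℝ) ^ ((1 : ℝ) / m)) atTop atTop :=
    (tendsto_rpow_atTop (by positivity)).comp hnat
  have h1 : (fun n : ℕ => Real.log (sPermProb S n * (n ! : ℝ) ^ ((1 : ℝ) / (m : ℝ)) /
      ((n : ℝ) ^ (-(1 / 2 : ℝ) + 1 / (2 * (m : ℝ))) *
        Real.exp ((leadingPoly S m).eval ((n : ℝ) ^ ((1 : ℝ) / (m : ℝ)))))))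
      =o[atTop] fun n : ℕ => (n : ℝ) :=
    (hlog.isBigO_one ℝ).trans_isLittleO
      ((isLittleO_one_left_iff ℝ).2 (tendsto_norm_atTop_atTop.comp hnat))
  have h2 : (fun n : ℕ => (-(1 / 2 : ℝ) + 1 / (2 * (m : ℝ))) * Real.log n)
      =o[atTop] fun n : ℕ => (n : ℝ) :=
    (Real.isLittleO_log_id_atTop.comp_tendsto hnat).const_mul_left _
  have h3 : (fun n : ℕ => (leadingPoly S m).eval ((n : ℝ) ^ ((1 : ℝ) / (m : ℝ))))
      =o[atTop] fun n : ℕ => (n : ℝ) := by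
    have hdeg : (leadingPoly S m).degree < (Polynomial.X ^ m : ℝ[X]).degree := by
      rw [Polynomial.degree_X_pow]
      refine (Polynomial.degree_le_natDegree).trans_lt ?_
      have := natDegree_leadingPoly_le S m
      exact_mod_cast (show (leadingPoly S m).natDegree < m by omega)
    have h := (Polynomial.isLittleO_atTop_of_degree_lt _ _ hdeg).comp_tendsto hx
    refine h.congr_right fun n => ?_
    rw [Function.comp_apply, Polynomial.eval_pow, Polynomial.eval_X, one_div,
      Real.rpow_inv_natCast_pow (Nat.cast_nonneg n) hm1.ne']
  have hlim := (tendsto_log_div_log_factorial ((h1.add h2).add h3)).sub_const (1 / (m : ℝ))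
  rw [zero_sub] at hlim
  refine hlim.congr' ?_
  filter_upwards [eventually_ge_atTop 3, hnorm.eventually_const_lt hC] with n hn hp
  have hn0 : (0 : ℝ) < n := by exact_mod_cast (show 0 < n by omega)
  have hf0 : (0 : ℝ) < n ! := by exact_mod_cast Nat.factorial_pos n
  have hlogf : Real.log (n ! : ℝ) ≠ 0 := by
    have : 1 < n ! := Nat.one_lt_factorial.2 (by omega)
    exact (Real.log_pos (by exact_mod_cast this)).ne'
  -- `p_n` can vanish for small `n`; the positive limit of the normalised ratio excludes this
  -- eventually, so the logarithm splits.
  have hp0 : sPermProb S n ≠ 0 := by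
    intro h
    rw [h, zero_mul, zero_div] at hp
    exact lt_irrefl _ hp
  rw [Real.log_div (by positivity) (by positivity), Real.log_mul hp0 (by positivity),
    Real.log_mul (by positivity) (by positivity), Real.log_exp, Real.log_rpow hf0,
    Real.log_rpow hn0]
  field_simp
  ring

end Asymptotics

theorem theorem1 (S : Finset ℕ) (m : ℕ) (hpos : ∀ s ∈ S, 0 < s) (hgcd : S.gcd id = 1)
    (hm : IsGreatest (S : Set ℕ) m) :
    ((fun n : ℕ => sPermProb S n * (n ! : ℝ) ^ ((1 : ℝ) / (m : ℝ))) ~[atTop]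
      (fun n : ℕ => leadingConst S m * (n : ℝ) ^ (-(1 / 2 : ℝ) + 1 / (2 * (m : ℝ))) *
        Real.exp ((leadingPoly S m).eval ((n : ℝ) ^ ((1 : ℝ) / (m : ℝ)))))) ∧
    0 < leadingConst S m ∧
    (leadingPoly S m).natDegree ≤ m - 1 ∧
    (leadingPoly S m).natDegree = (S.erase m).sup id ∧
    Tendsto (fun n : ℕ => Real.log (sPermProb S n) / Real.log (n ! : ℝ)) atTop
      (𝓝 (-(1 / (m : ℝ)))) := by
  have hm1 := hpos m hm.1
  have hC : 0 < leadingConst S m := leadingConst_pos hm1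
  refine ⟨?_, hC, natDegree_leadingPoly_le S m, natDegree_leadingPoly hpos hm,
    tendsto_log_sPermProb_div hpos hgcd hm⟩
  have hne : ∀ᶠ n : ℕ in atTop, leadingConst S m * (n : ℝ) ^ (-(1 / 2 : ℝ) + 1 / (2 * (m : ℝ))) *
      Real.exp ((leadingPoly S m).eval ((n : ℝ) ^ ((1 : ℝ) / (m : ℝ)))) ≠ 0 := by
    filter_upwards [eventually_gt_atTop 0] with n hn
    have : (0 : ℝ) < n := by exact_mod_cast hn
    positivity
  rw [isEquivalent_iff_tendsto_one hne]
  have h := (tendsto_sPermProb_normalized hpos hgcd hm).div_const (leadingConst S m)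
  rw [div_self hC.ne'] at h
  refine h.congr fun n => ?_
  rw [Pi.div_apply, div_div, mul_comm _ (leadingConst S m), ← mul_assoc]
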